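/- Let $n > m \ge 2$ be integers, let $A \subset \{0,1,\ldots,n-1\}\times\{0,1,\ldots,m-1\}$ be non-empty, and let \[ S = \left\{ \left( \sum_{i=1}^{\infty} \frac{x_i}{n^i},\ \sum_{i=1}^{\infty} \frac{y_i}{m^i} \right) : (x_i,y_i) \in A \text{ for all } i \ge 1 \right\} \subset \mathbb{R}^2 \] be the associated Bedford–McMullen carpet, with the Euclidean metric. For $0 \le j < m$ let $t_j$ be the number of elements of $A$ of the form $(i,j)$; let $t = \max_j t_j$ and let $s$ be the number of $j$ with $t_j \ne 0$. For a metric space $X$, let $\dim_A(X)$ be its Assouad dimension, i.e. the infimum of those $\alpha > 0$ for which there is a constant $C > 0$ such that whenever $0 < r \le R/2 \le \operatorname{diam}(X)$, every ball of radius $R$ in $X$ can be covered by at most $C(R/r)^\alpha$ balls of radius $r$; and let $\mathcal{C}\mathrm{dim}_A(X)$ be its conformal Assouad dimension, i.e. the infimum of $\dim_A(Y)$ over all metric spaces $Y$ for which there are a homeomorphism $f : X \to Y$ and a homeomorphism $\eta : [0,\infty) \to [0,\infty)$ such that $d(x,a) \le \tau\, d(x,b)$ implies $d(f(x),f(a))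 \le \eta(\tau)\, d(f(x),f(b))$ for all $x,a,b \in X$ and $\tau \ge 0$ (that is, $f$ is quasi-symmetric). If $t < n$ and $s < m$, then $\mathcal{C}\mathrm{dim}_A(S) = 0$. Otherwise (that is, if $t = n$ or $s = m$), $S$ is minimal for conformal Assouad dimension, i.e. $\mathcal{C}\mathrm{dim}_A(S) = \dim_A(S)$. -/

import Mathlib

open scoped NNReal ENNReal

noncomputable section

namespace Carpet

universe u v

/-- `CoversAtRate X α C`: for all `0 < r ≤ R / 2 ≤ diam X`, every ball of radius `R` in `X` can be
covered by at most `C (R / r) ^ α` balls of radius `r`. The diameter is taken in `[0, ∞]`, so that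
the last restriction disappears when `X` is unbounded. -/
def CoversAtRate (X : Type u) [MetricSpace X] (α C : ℝ) : Prop :=
  ∀ (x : X) (r R : ℝ), 0 < r → r ≤ R / 2 →
    ENNReal.ofReal (R / 2) ≤ Metric.ediam (Set.univ : Set X) →
    ∃ F : Finset X, (F.card : ℝ) ≤ C * (R / r) ^ α ∧
      Metric.ball x R ⊆ ⋃ y ∈ F, Metric.ball y r

/-- The Assouad dimension of a metric space: the infimum of the exponents `α > 0` for which the
covering property holds with some constant `C > 0`; it is `∞` if there is no such exponent. -/
def assouadDim (X : Type u) [MetricSpace X] : ℝ≥0∞ :=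
  ⨅ (α : ℝ≥0) (_ : 0 < α ∧ ∃ C : ℝ, 0 < C ∧ CoversAtRate X α C), (α : ℝ≥0∞)

/-- A homeomorphism `f : X → Y` of metric spaces is quasi-symmetric if there is a homeomorphism
`η : [0, ∞) → [0, ∞)` such that `d(x, a) ≤ t d(x, b)` implies
`d(f x, f a) ≤ η(t) d(f x, f b)`. -/
def IsQuasisymmetric {X : Type u} {Y : Type v} [MetricSpace X] [MetricSpace Y] (f : X ≃ₜ Y) :
    Prop :=
  ∃ η : ℝ≥0 ≃ₜ ℝ≥0, ∀ (x a b : X) (t : ℝ≥0),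
    dist x a ≤ t * dist x b → dist (f x) (f a) ≤ η t * dist (f x) (f b)

/-- The conformal Assouad dimension of `X`: the infimum of the Assouad dimensions of all metric
spaces `Y` that are quasi-symmetrically homeomorphic to `X`. (Since `Y` is in bijection with `X`,
it is no restriction to take `Y` in the same universe.) -/
def conformalAssouadDim (X : Type u) [MetricSpace X] : ℝ≥0∞ :=
  ⨅ (Y : Type u) (_ : MetricSpace Y) (f : X ≃ₜ Y) (_ : IsQuasisymmetric f), assouadDim Y

/-- The Bedford–McMullen carpet `S(A)`, as a subset of the Euclidean plane. The digit sequences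
are indexed from `0`, hence the exponents `i + 1`. -/
def carpet {n m : ℕ} (A : Finset (Fin n × Fin m)) : Set (EuclideanSpace ℝ (Fin 2)) :=
  {p | ∃ d : ℕ → Fin n × Fin m, (∀ i, d i ∈ A) ∧
    p = !₂[∑' i : ℕ, (((d i).1 : ℕ) : ℝ) / (n : ℝ) ^ (i + 1),
           ∑' i : ℕ, (((d i).2 : ℕ) : ℝ) / (m : ℝ) ^ (i + 1)]}

/-- `t_j`: the number of elements of `A` in the row `j`. -/
def rowCount {n m : ℕ} (A : Finset (Fin n × Fin m)) (j : Fin m) : ℕ :=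
  (A.filter fun a => a.2 = j).card

/-- `t`: the largest number of elements of `A` in one row. -/
def maxRow {n m : ℕ} (A : Finset (Fin n × Fin m)) : ℕ :=
  Finset.univ.sup (rowCount A)

/-- `s`: the number of rows that contain an element of `A`. -/
def numRows {n m : ℕ} (A : Finset (Fin n × Fin m)) : ℕ :=
  (Finset.univ.filter fun j => rowCount A j ≠ 0).card

end Carpet

end

open scoped NNReal ENNReal

namespace Carpet

universe u v

/-! Write t for `maxRow A`, s for `numRows A` and Q = log t / log n + log s / log m (`carpetDim`).
Covering by approximate squares shows that Q is an admissible covering exponent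
(`exists_covers_carpet`): refining by one x-digit costs a factor t, since its row is already known
at the finer vertical depth, and refining by one y-digit costs a factor s.

If t < n and s < m, the carpet is uniformly disconnected: a chain with steps shorter than ε has
endpoints within O(ε) of each other (`dist_le_of_chain`). Empty rows block vertical motion.
Horizontally, a strip between two empty rows meets at most two consecutive y-prefixes; each of them
misses an x-digit, and using one digit position for each yields a pair of digits forbidden
throughout the strip. The chain distance is then an ultrametric comparable to the metric. All its
powers are metrics quasi-symmetric to the original, and the k-th power divides covering exponents by
k, so the infimum is 0 (`conformalAssouadDim_eq_zero_of_chain`).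

If t = n or s = m, one of the two terms of Q is 1; let D be the other. At suitable small scales the
carpet contains an approximate product of the set of a fullest row with the vertical projection. One
factor contains all grid points of an interval, which gives about M ^ D separated discrete curves
with M steps (`HasChainGrid`). A quasi-symmetric image keeps every curve long. Hölder's inequality
with exponent 1 + D bounds below the sum of the (1 + D)-th powers of the relative step lengths,
whereas a covering exponent α < 1 + D makes that sum tend to 0 as M grows
(`one_add_le_of_hasChainGrid`). Hence Q = 1 + D is a lower bound for the conformal dimension, and it
is an upper bound for the Assouad dimension. -/

/-- The real number with base `b` expansion `0.f₀f₁f₂…`. -/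
noncomputable def digitVal (b : ℕ) (f : ℕ → ℕ) : ℝ := ∑' i, (f i : ℝ) / (b : ℝ) ^ (i + 1)

/-- The integer with base `b` expansion `f₀f₁…f_{k-1}`. -/
def digitPrefix (b : ℕ) (f : ℕ → ℕ) : ℕ → ℕ
  | 0 => 0
  | k + 1 => b * digitPrefix b f k + f k

/-! ### Digit expansions and their prefixes -/

section Digits

variable {b : ℕ} {f g : ℕ → ℕ}

theorem hasSum_maxDigits (hb : 2 ≤ b) :
    HasSum (fun i => ((b : ℝ) - 1) / (b : ℝ) ^ (i + 1)) 1 := by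
  have hb' : (2 : ℝ) ≤ b := by exact_mod_cast hb
  have h := (hasSum_geometric_of_lt_one (r := (b : ℝ)⁻¹) (by positivity)
    (inv_lt_one_of_one_lt₀ (by linarith))).mul_left (((b : ℝ) - 1) / b)
  have h0 : (b : ℝ) - 1 ≠ 0 := by linarith
  have h1 : ((b : ℝ) - 1) / b * (1 - (b : ℝ)⁻¹)⁻¹ = 1 := by field_simp
  have h2 : (fun i : ℕ => ((b : ℝ) - 1) / b * (b : ℝ)⁻¹ ^ i) =
      fun i => ((b : ℝ) - 1) / (b : ℝ) ^ (i + 1) := by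
    funext i
    rw [pow_succ, inv_pow]
    field_simp
  rwa [h1, h2] at h

theorem summable_digits (hb : 2 ≤ b) (hf : ∀ i, f i < b) :
    Summable fun i => (f i : ℝ) / (b : ℝ) ^ (i + 1) := by
  refine (hasSum_maxDigits hb).summable.of_nonneg_of_le (fun i => by positivity) fun i => ?_
  have : (f i : ℝ) + 1 ≤ b := by exact_mod_cast hf i
  gcongr
  linarith

theorem digitVal_nonneg : 0 ≤ digitVal b f := tsum_nonneg fun i => by positivity

theorem digitVal_le_one (hb : 2 ≤ b) (hf : ∀ i, f i < b) : digitVal b f ≤ 1 := by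
  rw [← (hasSum_maxDigits hb).tsum_eq]
  refine (summable_digits hb hf).tsum_le_tsum (fun i => ?_) (hasSum_maxDigits hb).summable
  have : (f i : ℝ) + 1 ≤ b := by exact_mod_cast hf i
  gcongr
  linarith

theorem digitVal_mul_base (hb : 2 ≤ b) (hf : ∀ i, f i < b) :
    digitVal b f * b = f 0 + digitVal b fun i => f (i + 1) := by
  have hb' : (2 : ℝ) ≤ b := by exact_mod_cast hb
  rw [digitVal, (summable_digits hb hf).tsum_eq_zero_add, add_mul, digitVal, ← tsum_mul_right]
  congr 1
  · field_simp
    simp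
  · refine tsum_congr fun i => ?_
    rw [pow_succ (b : ℝ) (i + 1)]
    field_simp

theorem digitVal_mul_pow (hb : 2 ≤ b) (hf : ∀ i, f i < b) (k : ℕ) :
    digitVal b f * (b : ℝ) ^ k = digitPrefix b f k + digitVal b fun i => f (i + k) := by
  induction k with
  | zero => simp [digitPrefix]
  | succ k ih =>
    rw [pow_succ, ← mul_assoc, ih, add_mul, digitVal_mul_base hb fun i => hf _, digitPrefix]
    push_cast
    simp only [zero_add, add_assoc, add_comm 1 k]
    ring

theorem digitPrefix_le (hb : 2 ≤ b) (hf : ∀ i, f i < b) (k : ℕ) :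
    (digitPrefix b f k : ℝ) ≤ digitVal b f * (b : ℝ) ^ k := by
  rw [digitVal_mul_pow hb hf]
  linarith [@digitVal_nonneg b fun i => f (i + k)]

/-- The inequality is not strict, because a tail of digits b - 1 has value 1: the prefix need not be
the floor. Later arguments therefore work with closed unit intervals and with digit sequences rather
than with the numbers alone. -/
theorem le_digitPrefix_add_one (hb : 2 ≤ b) (hf : ∀ i, f i < b) (k : ℕ) :
    digitVal b f * (b : ℝ) ^ k ≤ digitPrefix b f k + 1 := by
  rw [digitVal_mul_pow hb hf]
  linarith [digitVal_le_one (f := fun i => f (i + k)) hb fun i => hf _]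

theorem digitPrefix_congr {k : ℕ} (h : ∀ i < k, f i = g i) :
    digitPrefix b f k = digitPrefix b g k := by
  induction k with
  | zero => rfl
  | succ k ih =>
    rw [digitPrefix, digitPrefix, ih fun i hi => h i (by omega), h k (by omega)]

theorem digitPrefix_add (k l : ℕ) :
    digitPrefix b f (k + l) =
      digitPrefix b f k * b ^ l + digitPrefix b (fun i => f (i + k)) l := by
  induction l with
  | zero => simp [digitPrefix]
  | succ l ih =>
    rw [← add_assoc, digitPrefix, ih, digitPrefix, add_comm l k]
    ring

theorem digitPrefix_lt (hf : ∀ i, f i < b) (k : ℕ) : digitPrefix b f k < b ^ k := by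
  induction k with
  | zero => simp [digitPrefix]
  | succ k ih =>
    rw [digitPrefix, pow_succ']
    calc b * digitPrefix b f k + f k < b * digitPrefix b f k + b := by have := hf k; omega
      _ = b * (digitPrefix b f k + 1) := by ring
      _ ≤ b * b ^ k := Nat.mul_le_mul_left _ ih

theorem digitPrefix_inj (hf : ∀ i, f i < b) (hg : ∀ i, g i < b) {k : ℕ}
    (h : digitPrefix b f k = digitPrefix b g k) : ∀ i < k, f i = g i := by
  induction k with
  | zero => simp
  | succ k ih =>
    have hb : 0 < b := (Nat.zero_le _).trans_lt (hf 0)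
    rw [digitPrefix, digitPrefix] at h
    have h1 : digitPrefix b f k = digitPrefix b g k := by
      have := congrArg (· / b) h
      simpa [Nat.mul_add_div hb, Nat.div_eq_of_lt (hf k), Nat.div_eq_of_lt (hg k)] using this
    intro i hi
    rcases Nat.lt_succ_iff_lt_or_eq.1 hi with hi | rfl
    · exact ih h1 i hi
    · rw [h1] at h
      omega

theorem abs_digitVal_sub_le (hb : 2 ≤ b) (hf : ∀ i, f i < b) (hg : ∀ i, g i < b) {k : ℕ}
    (h : ∀ i < k, f i = g i) : |digitVal b f - digitVal b g| ≤ ((b : ℝ) ^ k)⁻¹ := by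
  have hb' : (0 : ℝ) < b := by exact_mod_cast (show 0 < b by omega)
  rw [← one_div, le_div_iff₀ (by positivity), ← abs_of_pos (pow_pos hb' k), ← abs_mul,
    sub_mul, digitVal_mul_pow hb hf, digitVal_mul_pow hb hg,
    digitPrefix_congr h, add_sub_add_left_eq_sub, abs_le]
  have h1 := @digitVal_nonneg b fun i => f (i + k)
  have h2 := @digitVal_nonneg b fun i => g (i + k)
  have h3 := digitVal_le_one (f := fun i => f (i + k)) hb fun i => hf _
  have h4 := digitVal_le_one (f := fun i => g (i + k)) hb fun i => hg _
  constructor <;> linarith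

theorem digitPrefix_div (i L : ℕ) (hi : i < b ^ L) :
    digitPrefix b (fun q => i / b ^ (L - 1 - q) % b) L = i := by
  -- Induction on the prefix length: the first q of the L padded digits of i spell the quotient of i
  -- by b ^ (L - q).
  have key : ∀ q ≤ L, digitPrefix b (fun q => i / b ^ (L - 1 - q) % b) q = i / b ^ (L - q) := by
    intro q
    induction q with
    | zero => simp [digitPrefix, Nat.div_eq_of_lt hi]
    | succ q ih =>
      intro hq
      rw [digitPrefix, ih (by omega), show L - q = (L - 1 - q) + 1 by omega, pow_succ,
        ← Nat.div_div_eq_div_mul, Nat.div_add_mod, show L - (q + 1) = L - 1 - q by omega]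
  simpa using key L le_rfl

end Digits

/-! ### Coverings of the carpet by approximate squares -/

/-- The point of the plane with the digit sequence `d`. -/
noncomputable def digitPoint {n m : ℕ} (d : ℕ → Fin n × Fin m) : EuclideanSpace ℝ (Fin 2) :=
  !₂[digitVal n fun i => (d i).1, digitVal m fun i => (d i).2]

theorem mem_carpet {n m : ℕ} {A : Finset (Fin n × Fin m)} {p : EuclideanSpace ℝ (Fin 2)} :
    p ∈ carpet A ↔ ∃ d : ℕ → Fin n × Fin m, (∀ i, d i ∈ A) ∧ p = digitPoint d := Iff.rfl

theorem abs_coord_sub_le_dist (p q : EuclideanSpace ℝ (Fin 2)) (i : Fin 2) :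
    |p i - q i| ≤ dist p q := by
  rw [← Real.dist_eq]
  exact (PiLp.lipschitzWith_ofLp 2 _).dist_le_mul p q |>.trans' (dist_le_pi_dist p.ofLp q.ofLp i)
    |>.trans (by simp)

theorem dist_le_abs_coord_sub_add (p q : EuclideanSpace ℝ (Fin 2)) :
    dist p q ≤ |p 0 - q 0| + |p 1 - q 1| := by
  rw [EuclideanSpace.dist_eq, Fin.sum_univ_two, Real.dist_eq, Real.dist_eq]
  refine Real.sqrt_le_iff.2 ⟨by positivity, ?_⟩
  nlinarith [abs_nonneg (p 0 - q 0), abs_nonneg (p 1 - q 1)]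

theorem dist_carpet_le_two {n m : ℕ} {A : Finset (Fin n × Fin m)} (hn : 2 ≤ n) (hm : 2 ≤ m)
    (p q : carpet A) : dist p q ≤ 2 := by
  obtain ⟨d, -, hd⟩ := mem_carpet.1 p.2
  obtain ⟨d', -, hd'⟩ := mem_carpet.1 q.2
  have a0 := abs_digitVal_sub_le hn (fun i => (d i).1.2) (fun i => (d' i).1.2) (k := 0) (by simp)
  have a1 := abs_digitVal_sub_le hm (fun i => (d i).2.2) (fun i => (d' i).2.2) (k := 0) (by simp)
  have := dist_le_abs_coord_sub_add p.1 q.1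
  have e0 : p.1 0 - q.1 0 = digitVal n (fun i => (d i).1) - digitVal n fun i => (d' i).1 := by
    rw [hd, hd']; rfl
  have e1 : p.1 1 - q.1 1 = digitVal m (fun i => (d i).2) - digitVal m fun i => (d' i).2 := by
    rw [hd, hd']; rfl
  rw [e0, e1] at this
  rw [Subtype.dist_eq]
  norm_num at a0 a1
  linarith

/-- One representative is chosen in each fibre of `key`, and its ball contains the fibre. -/
theorem exists_cover_of_key {X κ : Type*} [MetricSpace X] (s : Set X) (key : X → κ)
    (K : Finset κ) (hK : ∀ x ∈ s, key x ∈ K) (r : ℝ)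
    (h : ∀ x ∈ s, ∀ y ∈ s, key x = key y → dist x y < r) :
    ∃ F : Finset X, F.card ≤ K.card ∧ s ⊆ ⋃ y ∈ F, Metric.ball y r := by
  classical
  rcases s.eq_empty_or_nonempty with rfl | ⟨x₀, -⟩
  · exact ⟨∅, by simp, by simp⟩
  have : Nonempty X := ⟨x₀⟩
  refine ⟨K.image (Function.invFunOn key s), Finset.card_image_le, fun x hx => ?_⟩
  have hex : ∃ a ∈ s, key a = key x := ⟨x, hx, rfl⟩
  simp only [Set.mem_iUnion, Metric.mem_ball]
  exact ⟨_, Finset.mem_image_of_mem _ (hK x hx),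
    h _ hx _ (Function.invFunOn_mem hex) (Function.invFunOn_eq hex).symm⟩

theorem exists_injOn_lt_card {α : Type*} (B : Finset α) :
    ∃ c : α → ℕ, Set.InjOn c B ∧ ∀ a ∈ B, c a < B.card := by
  classical
  refine ⟨fun a => if h : a ∈ B then B.equivFin ⟨a, h⟩ else 0, fun a ha a' ha' h => ?_,
    fun a ha => ?_⟩
  · have ha := Finset.mem_coe.1 ha
    have ha' := Finset.mem_coe.1 ha'
    simp only [ha, ha', dif_pos] at h
    simpa using B.equivFin.injective (Fin.ext h)
  · simp [ha]

/-- `k` is the last scale with `x ≤ b ^ (-k)`. -/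
def IsScale (b : ℕ) (x : ℝ) (k : ℕ) : Prop := x ≤ ((b : ℝ) ^ k)⁻¹ ∧ ((b : ℝ) ^ (k + 1))⁻¹ < x

theorem exists_isScale {b : ℕ} (hb : 2 ≤ b) {x : ℝ} (hx : 0 < x) (hx1 : x ≤ 1) :
    ∃ k, IsScale b x k := by
  have hb' : (2 : ℝ) ≤ b := by exact_mod_cast hb
  obtain ⟨k, h1, h2⟩ := exists_nat_pow_near (one_le_inv₀ hx |>.2 hx1)
    (show (1 : ℝ) < b by linarith)
  refine ⟨k, ?_, ?_⟩
  · exact (le_inv_comm₀ (by positivity) hx).1 h1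
  · exact (inv_lt_comm₀ (by positivity) hx).2 h2

theorem IsScale.le {b : ℕ} (hb : 2 ≤ b) {x y : ℝ} (hxy : x ≤ y) {k l : ℕ}
    (hk : IsScale b y k) (hl : IsScale b x l) : k ≤ l := by
  have hb' : (2 : ℝ) ≤ b := by exact_mod_cast hb
  have h := (hl.2.trans_le hxy).trans_le hk.1
  rw [inv_lt_inv₀ (by positivity) (by positivity)] at h
  have := (pow_lt_pow_iff_right₀ (by linarith : (1 : ℝ) < b)).1 h
  omega

/-- Each of the two roundings to a power of b costs at most a factor b, hence b ^ 2. -/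
theorem IsScale.pow_sub_le {b : ℕ} (hb : 2 ≤ b) {x y : ℝ} (hx : 0 < x) (hxy : x ≤ y) {k l : ℕ}
    (hk : IsScale b y k) (hl : IsScale b x l) :
    (b : ℝ) ^ (l + 1 - k) ≤ (b : ℝ) ^ 2 * (y / x) := by
  have hb' : (2 : ℝ) ≤ b := by exact_mod_cast hb
  have hkl := hk.le hb hxy hl
  have h1 : (b : ℝ) ^ (l + 1 - k) = (b : ℝ) ^ 2 * (((b : ℝ) ^ (k + 1))⁻¹ * (b : ℝ) ^ l) := by
    have h2 : (b : ℝ) ^ (l + 1 - k) * (b : ℝ) ^ k = (b : ℝ) ^ (l + 1) := by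
      rw [← pow_add, Nat.sub_add_cancel (by omega)]
    rw [eq_comm, ← mul_left_inj' (show (b : ℝ) ^ k ≠ 0 by positivity), h2]
    field_simp
    ring
  rw [h1, div_eq_mul_inv]
  have h3 : (b : ℝ) ^ l ≤ x⁻¹ := (le_inv_comm₀ hx (by positivity)).1 hl.1
  have h4 := hk.2.le
  have : 0 < y := hx.trans_le hxy
  gcongr

theorem IsScale.le_of_base_le {b c : ℕ} (hb : 2 ≤ b) (hbc : b ≤ c) {x : ℝ} {k l : ℕ}
    (hk : IsScale c x k) (hl : IsScale b x l) : k ≤ l := by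
  have hb' : (2 : ℝ) ≤ b := by exact_mod_cast hb
  have hbc' : (b : ℝ) ≤ c := by exact_mod_cast hbc
  have h := hl.2.trans_le hk.1
  have h2 : ((b : ℝ) ^ k) ≤ (c : ℝ) ^ k := by gcongr
  rw [inv_lt_inv₀ (by positivity) (pow_pos (by linarith) _)] at h
  have := (pow_lt_pow_iff_right₀ (by linarith : (1 : ℝ) < b)).1 (h2.trans_lt h)
  omega

theorem natCast_pow_eq_rpow_logb {b q : ℕ} (hb : 2 ≤ b) (hq : 1 ≤ q) (e : ℕ) :
    (q : ℝ) ^ e = ((b : ℝ) ^ e) ^ Real.logb b q := by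
  have hb' : (2 : ℝ) ≤ b := by exact_mod_cast hb
  have hq' : (1 : ℝ) ≤ q := by exact_mod_cast hq
  rw [← Real.rpow_natCast (b : ℝ) e, ← Real.rpow_mul (by positivity), mul_comm,
    Real.rpow_mul (by positivity), Real.rpow_logb (by positivity) (by linarith) (by positivity),
    Real.rpow_natCast]

section

variable {n m : ℕ} {A : Finset (Fin n × Fin m)}

theorem rowCount_le_maxRow (j : Fin m) : rowCount A j ≤ maxRow A :=
  Finset.le_sup (f := rowCount A) (Finset.mem_univ j)

theorem rowCount_ne_zero {j : Fin m} : rowCount A j ≠ 0 ↔ ∃ i, (i, j) ∈ A := by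
  rw [rowCount, Finset.card_ne_zero]
  constructor
  · rintro ⟨⟨i, j'⟩, h⟩
    rw [Finset.mem_filter] at h
    obtain ⟨h, rfl⟩ := h
    exact ⟨i, h⟩
  · rintro ⟨i, h⟩
    exact ⟨(i, j), by simpa using h⟩

theorem one_le_maxRow (hA : A.Nonempty) : 1 ≤ maxRow A := by
  obtain ⟨⟨i, j⟩, h⟩ := hA
  exact (Nat.one_le_iff_ne_zero.2 (rowCount_ne_zero.2 ⟨i, h⟩)).trans (rowCount_le_maxRow j)

theorem one_le_numRows (hA : A.Nonempty) : 1 ≤ numRows A := by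
  obtain ⟨⟨i, j⟩, h⟩ := hA
  exact Finset.card_pos.2 ⟨j, by simpa using rowCount_ne_zero.2 ⟨i, h⟩⟩

/-- The Assouad dimension `log t / log n + log s / log m` of a Bedford–McMullen carpet. -/
noncomputable def carpetDim (A : Finset (Fin n × Fin m)) : ℝ :=
  Real.logb n (maxRow A) + Real.logb m (numRows A)

/-- The code `c` separates elements only within a row. This is why its range has size t rather than
the size of A, and why it must be read together with the row. -/
theorem exists_row_codes (A : Finset (Fin n × Fin m)) :
    ∃ (c : Fin n × Fin m → ℕ) (e : Fin m → ℕ), (∀ a ∈ A, c a < maxRow A ∧ e a.2 < numRows A) ∧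
      (∀ a ∈ A, ∀ a' ∈ A, a.2 = a'.2 → c a = c a' → a = a') ∧
      ∀ a ∈ A, ∀ a' ∈ A, e a.2 = e a'.2 → a.2 = a'.2 := by
  choose c hc hlt using fun j : Fin m => exists_injOn_lt_card (A.filter fun a => a.2 = j)
  obtain ⟨e, he, helt⟩ := exists_injOn_lt_card (Finset.univ.filter fun j => rowCount A j ≠ 0)
  have hrow : ∀ a ∈ A, a.2 ∈ Finset.univ.filter fun j => rowCount A j ≠ 0 := fun a ha => by
    simpa using rowCount_ne_zero.2 ⟨a.1, ha⟩
  refine ⟨fun a => c a.2 a, e, fun a ha => ⟨?_, helt _ (hrow a ha)⟩, ?_,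
    fun a ha a' ha' h => he (hrow a ha) (hrow a' ha') h⟩
  · exact (hlt a.2 a (by simpa using ha)).trans_le (rowCount_le_maxRow a.2)
  · intro a ha a' ha' h1 h2
    simp only [← h1] at h2
    exact hc a.2 (by simpa using ha) (by simpa [h1] using ha') h2

/-- After scaling by b ^ k the values differ by less than 4, and each prefix is within 1 below its
value. Truncated subtraction at 0 only shortens the interval. -/
theorem digitPrefix_mem_Icc {b : ℕ} (hb : 2 ≤ b) {f g : ℕ → ℕ} (hf : ∀ i, f i < b)
    (hg : ∀ i, g i < b) {R : ℝ} {k : ℕ} (hk : IsScale b (R / 4) k)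
    (h : |digitVal b f - digitVal b g| < R) :
    digitPrefix b f k ∈ Finset.Icc (digitPrefix b g k - 5) (digitPrefix b g k + 5) := by
  have hb' : (0 : ℝ) < b := by exact_mod_cast (show 0 < b by omega)
  have hR : R * (b : ℝ) ^ k ≤ 4 := by
    have := hk.1
    rw [← one_div, le_div_iff₀ (by positivity)] at this
    linarith
  have hp : (0 : ℝ) < (b : ℝ) ^ k := by positivity
  have h1 := digitPrefix_le hb hf k
  have h2 := digitPrefix_le hb hg k
  have h3 := le_digitPrefix_add_one hb hf k
  have h4 := le_digitPrefix_add_one hb hg k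
  rw [abs_lt] at h
  have h5 := mul_lt_mul_of_pos_right h.1 hp
  have h6 := mul_lt_mul_of_pos_right h.2 hp
  have h7 : (digitPrefix b f k : ℝ) ≤ digitPrefix b g k + 5 := by linarith
  have h8 : (digitPrefix b g k : ℝ) ≤ digitPrefix b f k + 5 := by linarith
  norm_cast at h7 h8
  rw [Finset.mem_Icc]
  omega

theorem exists_cover_carpet_of_isScale (hm : 2 ≤ m) (hmn : m < n) (p : carpet A) {r R : ℝ}
    {k l k' l' : ℕ} (hk : IsScale n (R / 4) k) (hl : IsScale m (R / 4) l)
    (hk' : IsScale n (r / 4) k') (hl' : IsScale m (r / 4) l') :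
    ∃ F : Finset (carpet A),
      F.card ≤ 121 * (maxRow A ^ (k' + 1 - k) * numRows A ^ (l' + 1 - l)) ∧
      Metric.ball p R ⊆ ⋃ y ∈ F, Metric.ball y r := by
  have hn : 2 ≤ n := by omega
  obtain ⟨c, e, hlt, hc, he⟩ := exists_row_codes A
  choose δ hδA hδ using fun x : carpet A => mem_carpet.1 x.2
  have hx : ∀ x : carpet A, ∀ i, ((δ x i).1 : ℕ) < n := fun x i => (δ x i).1.2
  have hy : ∀ x : carpet A, ∀ i, ((δ x i).2 : ℕ) < m := fun x i => (δ x i).2.2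
  have h0 : ∀ x : carpet A, x.1 0 = digitVal n fun i => (δ x i).1 := fun x => by
    rw [hδ x]; rfl
  have h1 : ∀ x : carpet A, x.1 1 = digitVal m fun i => (δ x i).2 := fun x => by
    rw [hδ x]; rfl
  -- The x-digits after position k are recorded only by their rank in the row. Since k' ≤ l', the
  -- rows themselves can be recovered from the components that describe the y-digits.
  let key : carpet A → ℕ × ℕ × (Fin (k' + 1 - k) → ℕ) × (Fin (l' + 1 - l) → ℕ) := fun x =>
    (digitPrefix n (fun i => (δ x i).1) k, digitPrefix m (fun i => (δ x i).2) l,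
      fun i => c (δ x (k + i)), fun i => e (δ x (l + i)).2)
  let a := digitPrefix n (fun i => (δ p i).1) k
  let b := digitPrefix m (fun i => (δ p i).2) l
  refine (exists_cover_of_key (Metric.ball p R) key
    (Finset.Icc (a - 5) (a + 5) ×ˢ Finset.Icc (b - 5) (b + 5) ×ˢ
      Fintype.piFinset (fun _ => Finset.range (maxRow A)) ×ˢ
      Fintype.piFinset (fun _ => Finset.range (numRows A))) ?_ r ?_).imp
    fun F hF => ⟨hF.1.trans ?_, hF.2⟩
  · intro x hx'
    have hd : dist x.1 p.1 < R := hx'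
    simp only [key, Finset.mem_product, Fintype.mem_piFinset, Finset.mem_range]
    refine ⟨?_, ?_, fun i => (hlt _ (hδA _ _)).1, fun i => (hlt _ (hδA _ _)).2⟩
    · refine digitPrefix_mem_Icc hn (hx x) (hx p) hk ?_
      rw [← h0, ← h0]
      exact (abs_coord_sub_le_dist _ _ 0).trans_lt hd
    · refine digitPrefix_mem_Icc hm (hy x) (hy p) hl ?_
      rw [← h1, ← h1]
      exact (abs_coord_sub_le_dist _ _ 1).trans_lt hd
  · intro x _ y _ hxy
    simp only [key, Prod.mk.injEq] at hxy
    obtain ⟨e1, e2, e3, e4⟩ := hxy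
    have hkl' : k' ≤ l' := hk'.le_of_base_le hm hmn.le hl'
    have hY : ∀ i < l' + 1, (δ x i).2 = (δ y i).2 := by
      intro i hi
      rcases lt_or_ge i l with h | h
      · exact Fin.ext (digitPrefix_inj (hy x) (hy y) e2 i h)
      · have := congrFun e4 ⟨i - l, by omega⟩
        simp only [Nat.add_sub_cancel' h] at this
        exact he _ (hδA _ _) _ (hδA _ _) this
    have hX : ∀ i < k' + 1, (δ x i).1 = (δ y i).1 := by
      intro i hi
      rcases lt_or_ge i k with h | h
      · exact Fin.ext (digitPrefix_inj (hx x) (hx y) e1 i h)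
      · have := congrFun e3 ⟨i - k, by omega⟩
        simp only [Nat.add_sub_cancel' h] at this
        rw [hc _ (hδA _ _) _ (hδA _ _) (hY i (by omega)) this]
    have d0 := abs_digitVal_sub_le hn (hx x) (hx y) fun i hi => congrArg Fin.val (hX i hi)
    have d1 := abs_digitVal_sub_le hm (hy x) (hy y) fun i hi => congrArg Fin.val (hY i hi)
    rw [← h0, ← h0] at d0
    rw [← h1, ← h1] at d1
    have := dist_le_abs_coord_sub_add x.1 y.1
    rw [Subtype.dist_eq]
    have hr : 0 < r / 4 := hk'.2.trans' (by positivity)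
    linarith [hk'.2, hl'.2]
  · simp only [Finset.card_product, Nat.card_Icc, Fintype.card_piFinset, Finset.card_range,
      Finset.prod_const, Finset.card_univ, Fintype.card_fin]
    rw [← mul_assoc]
    gcongr
    calc _ ≤ 11 * 11 := Nat.mul_le_mul (by omega) (by omega)
      _ = 121 := rfl

theorem logb_natCast_nonneg {b q : ℕ} (hb : 2 ≤ b) (hq : 1 ≤ q) : 0 ≤ Real.logb b q :=
  Real.logb_nonneg (by exact_mod_cast (show 1 < b by omega)) (by exact_mod_cast hq)

theorem natCast_pow_le_of_isScale {b q : ℕ} (hb : 2 ≤ b) (hq : 1 ≤ q) {r R : ℝ} (hr : 0 < r)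
    (hrR : r ≤ R) {k k' : ℕ} (hk : IsScale b (R / 4) k) (hk' : IsScale b (r / 4) k') :
    (q : ℝ) ^ (k' + 1 - k) ≤ ((b : ℝ) ^ 2) ^ Real.logb b q * (R / r) ^ Real.logb b q := by
  have hR : 0 < R := hr.trans_le hrR
  rw [natCast_pow_eq_rpow_logb hb hq, ← Real.mul_rpow (by positivity) (by positivity)]
  refine Real.rpow_le_rpow (by positivity) ?_ (logb_natCast_nonneg hb hq)
  have := hk.pow_sub_le hb (by positivity) (by linarith) hk'
  rwa [div_div_div_cancel_right₀ (by norm_num)] at this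

theorem exists_covers_carpet (hm : 2 ≤ m) (hmn : m < n) (hA : A.Nonempty) :
    ∃ C : ℝ, 1 ≤ C ∧ ∀ (p : carpet A) (r R : ℝ), 0 < r → r ≤ R →
      ∃ F : Finset (carpet A), (F.card : ℝ) ≤ C * (R / r) ^ carpetDim A ∧
        Metric.ball p R ⊆ ⋃ y ∈ F, Metric.ball y r := by
  have hn : 2 ≤ n := by omega
  have ht := one_le_maxRow hA
  have hs := one_le_numRows hA
  have hT := logb_natCast_nonneg hn ht
  have hS := logb_natCast_nonneg hm hs
  have hQ : 0 ≤ carpetDim A := add_nonneg hT hS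
  have hn' : (2 : ℝ) ≤ n := by exact_mod_cast hn
  have hm' : (2 : ℝ) ≤ m := by exact_mod_cast hm
  set C : ℝ := 121 * (((n : ℝ) ^ 2) ^ Real.logb n (maxRow A) *
    ((m : ℝ) ^ 2) ^ Real.logb m (numRows A)) with hC
  have hC1 : 1 ≤ C := by
    have h1 := Real.one_le_rpow (show (1 : ℝ) ≤ (n : ℝ) ^ 2 by nlinarith) hT
    have h2 := Real.one_le_rpow (show (1 : ℝ) ≤ (m : ℝ) ^ 2 by nlinarith) hS
    have := one_le_mul_of_one_le_of_one_le h1 h2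
    linarith
  -- The bound R ≤ 4 makes R / 4 at most 1, so that it has a scale. Larger radii add nothing, as the
  -- diameter is at most 2.
  have main : ∀ (p : carpet A) (r R : ℝ), 0 < r → r ≤ R → R ≤ 4 →
      ∃ F : Finset (carpet A), (F.card : ℝ) ≤ C * (R / r) ^ carpetDim A ∧
        Metric.ball p R ⊆ ⋃ y ∈ F, Metric.ball y r := by
    intro p r R hr hrR hR
    have hR0 : 0 < R := hr.trans_le hrR
    obtain ⟨k, hk⟩ := exists_isScale hn (x := R / 4) (by positivity) (by linarith)
    obtain ⟨l, hl⟩ := exists_isScale hm (x := R / 4) (by positivity) (by linarith)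
    obtain ⟨k', hk'⟩ := exists_isScale hn (x := r / 4) (by positivity) (by linarith)
    obtain ⟨l', hl'⟩ := exists_isScale hm (x := r / 4) (by positivity) (by linarith)
    obtain ⟨F, hF, hcov⟩ := exists_cover_carpet_of_isScale hm hmn p hk hl hk' hl'
    refine ⟨F, (Nat.cast_le.2 hF).trans ?_, hcov⟩
    push_cast
    rw [carpetDim, Real.rpow_add (by positivity), hC, mul_assoc 121, mul_mul_mul_comm]
    gcongr
    · exact natCast_pow_le_of_isScale hn ht hr hrR hk hk'
    · exact natCast_pow_le_of_isScale hm hs hr hrR hl hl'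
  have hdiam : ∀ p q : carpet A, dist p q < 4 := fun p q =>
    (dist_carpet_le_two hn hm p q).trans_lt (by norm_num)
  refine ⟨C, hC1, fun p r R hr hrR => ?_⟩
  rcases le_or_gt R 4 with hR | hR
  · exact main p r R hr hrR hR
  rcases le_or_gt r 4 with hr4 | hr4
  · obtain ⟨F, hF, hcov⟩ := main p r 4 hr hr4 le_rfl
    refine ⟨F, hF.trans ?_, fun x _ => hcov (hdiam x p)⟩
    gcongr
  · refine ⟨{p}, ?_, fun x _ => ?_⟩
    · have := Real.one_le_rpow ((one_le_div hr).2 hrR) hQ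
      simpa using one_le_mul_of_one_le_of_one_le hC1 this
    · simpa using (hdiam x p).trans hr4

end

/-! ### Uniformly disconnected spaces have conformal Assouad dimension zero -/

section Ultrametric

/-- The infimum of the `ε` for which two points are joined by a chain with steps shorter than
`ε`. -/
noncomputable def chainDist {X : Type u} [MetricSpace X] (x y : X) : ℝ :=
  sInf {ε | 0 < ε ∧ Relation.ReflTransGen (fun a b => dist a b < ε) x y}

variable {X : Type u} [MetricSpace X]

theorem chainDist_le_of_chain {x y : X} {ε : ℝ} (hε : 0 < ε)
    (h : Relation.ReflTransGen (fun a b => dist a b < ε) x y) : chainDist x y ≤ ε :=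
  csInf_le ⟨0, fun _ h => h.1.le⟩ ⟨hε, h⟩

theorem exists_chain_of_chainDist_lt {x y : X} {ε : ℝ} (h : chainDist x y < ε) :
    0 < ε ∧ Relation.ReflTransGen (fun a b => dist a b < ε) x y := by
  have hne : {ε | 0 < ε ∧ Relation.ReflTransGen (fun a b => dist a b < ε) x y}.Nonempty :=
    ⟨dist x y + 1, by positivity, Relation.ReflTransGen.single (by simp)⟩
  obtain ⟨ε', ⟨h0, h1⟩, h2⟩ := exists_lt_of_csInf_lt hne h
  exact ⟨h0.trans h2, Relation.ReflTransGen.mono (fun a b hab => lt_trans hab h2) _ _ h1⟩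

theorem chainDist_nonneg (x y : X) : 0 ≤ chainDist x y := Real.sInf_nonneg fun _ h => h.1.le

theorem chainDist_le_dist (x y : X) : chainDist x y ≤ dist x y :=
  le_of_forall_gt_imp_ge_of_dense fun _ h =>
    chainDist_le_of_chain (dist_nonneg.trans_lt h) (Relation.ReflTransGen.single h)

theorem chainDist_comm (x y : X) : chainDist x y = chainDist y x := by
  have h : ∀ (ε : ℝ) (x y : X), Relation.ReflTransGen (fun a b => dist a b < ε) x y →
      Relation.ReflTransGen (fun a b => dist a b < ε) y x := fun ε x y h => by
    have : Std.Symm fun a b : X => dist a b < ε := ⟨fun a b hab => by rwa [dist_comm]⟩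
    exact Relation.ReflTransGen.stdSymm.symm _ _ h
  unfold chainDist
  congr 1
  ext ε
  exact and_congr_right fun _ => ⟨h ε x y, h ε y x⟩

theorem chainDist_le_max (x y z : X) : chainDist x z ≤ max (chainDist x y) (chainDist y z) := by
  refine le_of_forall_gt_imp_ge_of_dense fun ε hε => ?_
  obtain ⟨h0, h1⟩ := exists_chain_of_chainDist_lt ((le_max_left _ _).trans_lt hε)
  obtain ⟨-, h2⟩ := exists_chain_of_chainDist_lt ((le_max_right _ _).trans_lt hε)
  exact chainDist_le_of_chain h0 (h1.trans h2)

/-- A copy of `X`, to be endowed with a power of the chain distance. -/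
def ChainCopy (X : Type u) : Type u := X

/-- The hypothesis on chains gives `chainDist` ≤ `dist` ≤ K `chainDist`. By the ultrametric
inequality the k-th power of `chainDist` is still a metric, and the identity map is quasi-symmetric
with η(t) = (K t) ^ k. The covering hypothesis is assumed for all r ≤ R, without a diameter
restriction, because it is applied to k-th roots of the new radii. -/
theorem exists_isQuasisymmetric_assouadDim_le {C K Q : ℝ} (hC : 0 < C) (hQ : 0 ≤ Q)
    (hcov : ∀ (p : X) (r R : ℝ), 0 < r → r ≤ R →
      ∃ F : Finset X, (F.card : ℝ) ≤ C * (R / r) ^ Q ∧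
        Metric.ball p R ⊆ ⋃ y ∈ F, Metric.ball y r)
    (hK : 1 ≤ K) (hchain : ∀ (ε : ℝ), 0 < ε → ∀ x y : X,
      Relation.ReflTransGen (fun a b => dist a b < ε) x y → dist x y ≤ K * ε)
    (k : ℕ) (hk : k ≠ 0) :
    ∃ (_ : MetricSpace (ChainCopy X)) (f : X ≃ₜ ChainCopy X), IsQuasisymmetric f ∧
      assouadDim (ChainCopy X) ≤ ENNReal.ofReal ((Q + 1) / k) := by
  have hle : ∀ x y : X, dist x y ≤ K * chainDist x y := by
    intro x y
    rw [← div_le_iff₀' (by positivity)]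
    refine le_of_forall_gt_imp_ge_of_dense fun ε hε => ?_
    obtain ⟨h0, h1⟩ := exists_chain_of_chainDist_lt hε
    rw [div_le_iff₀' (by positivity)]
    exact hchain ε h0 x y h1
  have hzero : ∀ x y : X, chainDist x y = 0 → x = y := by
    intro x y h
    have h2 := hle x y
    rw [h, mul_zero] at h2
    exact dist_le_zero.1 h2
  let inst : MetricSpace (ChainCopy X) :=
    { dist := fun x y : X => chainDist x y ^ k
      dist_self := fun x : X => by
        have : chainDist x x = 0 :=
          le_antisymm ((chainDist_le_dist x x).trans (dist_self x).le) (chainDist_nonneg _ _)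
        change chainDist x x ^ k = 0
        rw [this, zero_pow hk]
      dist_comm := fun x y : X => congrArg (· ^ k) (chainDist_comm x y)
      dist_triangle := fun x y z : X => by
        have h1 := pow_le_pow_left₀ (chainDist_nonneg x z) (chainDist_le_max x y z) k
        have h2 := pow_nonneg (chainDist_nonneg x y) k
        have h3 := pow_nonneg (chainDist_nonneg y z) k
        rcases max_choice (chainDist x y) (chainDist y z) with h | h <;> rw [h] at h1 <;> linarith
      eq_of_dist_eq_zero := by
        intro (x : X) (y : X) h
        have h1 : chainDist x y = 0 := eq_zero_of_pow_eq_zero h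
        exact hzero x y h1 }
  have hKpos : (0 : ℝ) < K := by linarith
  let f : X ≃ₜ ChainCopy X :=
    { toFun := fun x => x
      invFun := fun x => x
      left_inv := fun _ => rfl
      right_inv := fun _ => rfl
      continuous_toFun := by
        refine Metric.continuous_iff.2 fun b ε hε => ⟨min ε 1, by positivity, fun a hab => ?_⟩
        change chainDist a b ^ k < ε
        have h1 := (chainDist_le_dist a b).trans_lt hab
        exact (pow_le_of_le_one (chainDist_nonneg a b) (h1.le.trans (min_le_right _ _)) hk).trans_lt
          (h1.trans_le (min_le_left _ _))
      continuous_invFun := by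
        refine Metric.continuous_iff.2 fun (b : X) ε hε => ⟨(ε / K) ^ k, by positivity,
          fun (a : X) hab => ?_⟩
        change chainDist a b ^ k < (ε / K) ^ k at hab
        have h1 := lt_of_pow_lt_pow_left₀ k (by positivity) hab
        rw [lt_div_iff₀' hKpos] at h1
        exact (hle a b).trans_lt h1 }
  have hk' : (0 : ℝ) < k := by exact_mod_cast Nat.pos_of_ne_zero hk
  refine ⟨inst, f, ?_, ?_⟩
  · let K' : ℝ≥0 := ⟨K, hKpos.le⟩
    have hK' : K' ≠ 0 := fun h => hKpos.ne' (congrArg NNReal.toReal h)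
    refine ⟨(Homeomorph.mulLeft₀ K' hK').trans
      (NNReal.orderIsoRpow k hk').toHomeomorph, fun x a b t hab => ?_⟩
    change chainDist x a ^ k ≤ (((K' * t) ^ (k : ℝ) : ℝ≥0) : ℝ) * chainDist x b ^ k
    rw [NNReal.rpow_natCast]
    push_cast
    rw [← mul_pow]
    refine pow_le_pow_left₀ (chainDist_nonneg _ _) ?_ k
    calc chainDist x a ≤ dist x a := chainDist_le_dist x a
      _ ≤ t * dist x b := hab
      _ ≤ t * (K * chainDist x b) := by gcongr; exact hle x b
      _ = K * t * chainDist x b := by ring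
  -- Q + 1 replaces Q because the exponent must be positive even when Q = 0.
  · have hα : 0 < (Q + 1) / k := by positivity
    refine iInf₂_le_of_le (Real.toNNReal ((Q + 1) / k))
      ⟨Real.toNNReal_pos.2 hα, C * K ^ Q, by positivity, ?_⟩ le_rfl
    rw [Real.coe_toNNReal _ hα.le]
    intro (x : X) r R hr hrR _
    have hR : 0 < R := by linarith
    have hroot : ∀ s : ℝ, 0 < s → (s ^ (k⁻¹ : ℝ)) ^ k = s := fun s hs =>
      Real.rpow_inv_natCast_pow hs.le hk
    have hrR' : r ^ (k⁻¹ : ℝ) ≤ R ^ (k⁻¹ : ℝ) :=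
      Real.rpow_le_rpow hr.le (by linarith) (by positivity)
    -- A new ball of radius R lies in the old ball of radius K R ^ (1/k), and an old ball of radius
    -- r ^ (1/k) lies in the new ball of radius r.
    obtain ⟨F, hF, hcovF⟩ := hcov x (r ^ (k⁻¹ : ℝ)) (K * R ^ (k⁻¹ : ℝ)) (by positivity)
      (hrR'.trans (le_mul_of_one_le_left (by positivity) hK))
    refine ⟨F, hF.trans ?_, fun (y : X) (hy : chainDist y x ^ k < R) => ?_⟩
    · rw [mul_div_assoc, Real.mul_rpow hKpos.le (by positivity), ← mul_assoc,
        ← Real.div_rpow hR.le hr.le, ← Real.rpow_mul (by positivity)]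
      gcongr
      · rw [one_le_div hr]; linarith
      · rw [inv_mul_eq_div]
        gcongr
        linarith
    · rw [← hroot R hR] at hy
      have h2 := lt_of_pow_lt_pow_left₀ k (by positivity) hy
      have h3 : @dist X _ y x < K * R ^ (k⁻¹ : ℝ) :=
        (hle y x).trans_lt (mul_lt_mul_of_pos_left h2 hKpos)
      have h4 := hcovF h3
      obtain ⟨z, hz, hyz⟩ := Set.mem_iUnion₂.1 h4
      refine Set.mem_iUnion₂.2 ⟨z, hz, ?_⟩
      have h5 := (chainDist_le_dist y z).trans_lt hyz
      have h6 := pow_lt_pow_left₀ h5 (chainDist_nonneg _ _) hk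
      rw [hroot r hr] at h6
      exact h6

theorem conformalAssouadDim_eq_zero_of_chain {C K Q : ℝ} (hC : 0 < C) (hQ : 0 ≤ Q)
    (hcov : ∀ (p : X) (r R : ℝ), 0 < r → r ≤ R →
      ∃ F : Finset X, (F.card : ℝ) ≤ C * (R / r) ^ Q ∧
        Metric.ball p R ⊆ ⋃ y ∈ F, Metric.ball y r)
    (hK : 1 ≤ K) (hchain : ∀ (ε : ℝ), 0 < ε → ∀ x y : X,
      Relation.ReflTransGen (fun a b => dist a b < ε) x y → dist x y ≤ K * ε) :
    conformalAssouadDim X = 0 := by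
  have hle : ∀ k : ℕ, conformalAssouadDim X ≤ ENNReal.ofReal ((Q + 1) / (k + 1 : ℕ)) := by
    intro k
    obtain ⟨inst, f, hf, h⟩ :=
      exists_isQuasisymmetric_assouadDim_le hC hQ hcov hK hchain (k + 1) (by omega)
    exact (iInf₂_le_of_le (ChainCopy X) inst (iInf₂_le_of_le f hf le_rfl)).trans h
  refine le_antisymm (ge_of_tendsto' (x := Filter.atTop) ?_ hle) bot_le
  have h1 : Filter.Tendsto (fun k : ℕ => (Q + 1) / ((k + 1 : ℕ) : ℝ)) Filter.atTop (nhds 0) :=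
    (tendsto_const_div_atTop_nhds_zero_nat (Q + 1)).comp (Filter.tendsto_add_atTop_nat 1)
  simpa using ENNReal.tendsto_ofReal h1

end Ultrametric

/-! ### Uniform disconnectedness when t < n and s < m -/

section Disconnected

/-- Unit intervals are grouped into blocks of P, starting at residue ρ. The first interval of every
block is unoccupied, which leaves a gap of length at least 1 between the occupied parts of different
blocks. -/
theorem ediv_eq_of_abs_sub_lt_one {P ρ : ℤ} (hP : 0 < P) {N N' : ℤ} {v v' : ℝ} (h1 : (N : ℝ) ≤ v)
    (h2 : v ≤ N + 1) (h1' : (N' : ℝ) ≤ v') (h2' : v' ≤ N' + 1) (h : |v - v'| < 1)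
    (hN : (N - ρ) % P ≠ 0) (hN' : (N' - ρ) % P ≠ 0) : (N - ρ) / P = (N' - ρ) / P := by
  have key : ∀ {N N' : ℤ} {v v' : ℝ}, (N : ℝ) ≤ v → v ≤ N + 1 → (N' : ℝ) ≤ v' → v' ≤ N' + 1 →
      |v - v'| < 1 → (N - ρ) % P ≠ 0 → (N' - ρ) % P ≠ 0 → (N' - ρ) / P ≤ (N - ρ) / P := by
    intro N N' v v' _ h2 h1' _ h _ hN'
    by_contra! hlt
    have e := Int.emod_add_mul_ediv (N - ρ) P
    have e' := Int.emod_add_mul_ediv (N' - ρ) P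
    have l := Int.emod_lt_of_pos (N - ρ) hP
    have l' := Int.emod_nonneg (N' - ρ) hP.ne'
    have hmul : P * ((N - ρ) / P + 1) ≤ P * ((N' - ρ) / P) := by gcongr; omega
    -- N' lies in a later block and is not the first index of its block.
    have hNN : N + 2 ≤ N' := by
      rw [mul_add] at hmul
      omega
    have hNN' : (N : ℝ) + 2 ≤ N' := by exact_mod_cast hNN
    rw [abs_lt] at h
    linarith
  exact le_antisymm (key h1' h2' h1 h2 (by rwa [abs_sub_comm]) hN' hN)
    (key h1 h2 h1' h2' h hN hN')

theorem abs_sub_le_of_ediv_eq {P ρ : ℤ} (hP : 0 < P) {N N' : ℤ} {v v' : ℝ} (h1 : (N : ℝ) ≤ v)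
    (h2 : v ≤ N + 1) (h1' : (N' : ℝ) ≤ v') (h2' : v' ≤ N' + 1)
    (h : (N - ρ) / P = (N' - ρ) / P) : |v - v'| ≤ P := by
  have e := Int.emod_add_mul_ediv (N - ρ) P
  have e' := Int.emod_add_mul_ediv (N' - ρ) P
  have l := Int.emod_lt_of_pos (N - ρ) hP
  have l' := Int.emod_lt_of_pos (N' - ρ) hP
  have p := Int.emod_nonneg (N - ρ) hP.ne'
  have p' := Int.emod_nonneg (N' - ρ) hP.ne'
  rw [h] at e
  have a : (N : ℝ) + 1 ≤ N' + P := by exact_mod_cast (show N + 1 ≤ N' + P by omega)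
  have a' : (N' : ℝ) + 1 ≤ N + P := by exact_mod_cast (show N' + 1 ≤ N + P by omega)
  rw [abs_le]
  constructor <;> linarith

variable {n m : ℕ} {A : Finset (Fin n × Fin m)}

theorem exists_row_eq_zero (h : numRows A < m) : ∃ j, rowCount A j = 0 := by
  by_contra! hne
  have : numRows A = m := by simp [numRows, hne]
  omega

theorem exists_notMem_row (h : maxRow A < n) (j : Fin m) : ∃ i, (i, j) ∉ A := by
  by_contra! hmem
  have h1 : (Finset.univ.image fun i : Fin n => (i, j)) ⊆ A.filter fun a => a.2 = j := by
    intro a ha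
    obtain ⟨i, -, rfl⟩ := Finset.mem_image.1 ha
    simp [hmem]
  have h2 := (Finset.card_le_card h1).trans (rowCount_le_maxRow j)
  rw [Finset.card_image_of_injective _ fun a b hab => congrArg Prod.fst hab] at h2
  simp at h2
  omega

/-- The y-prefix fixes the row at position κ, and no row is full. The value v is an arbitrary
integer because the block index used later can be -1; if no sequence has prefix v, any digit will
do. -/
theorem exists_missing_digit (hn : 0 < n) (h : maxRow A < n) {κ l : ℕ} (hκ : κ < l) (v : ℤ) :
    ∃ i : Fin n, ∀ d : ℕ → Fin n × Fin m, (∀ q, d q ∈ A) →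
      (digitPrefix m (fun q => (d q).2) l : ℤ) = v → (d κ).1 ≠ i := by
  by_cases hex : ∃ d : ℕ → Fin n × Fin m, (digitPrefix m (fun q => (d q).2) l : ℤ) = v
  · obtain ⟨d, hd⟩ := hex
    obtain ⟨i, hi⟩ := exists_notMem_row h (d κ).2
    refine ⟨i, fun d' hA' hd' hi' => hi ?_⟩
    have := digitPrefix_inj (fun q => (d q).2.2) (fun q => (d' q).2.2)
      (by exact_mod_cast hd.trans hd'.symm) κ hκ
    rw [← hi', Fin.ext this]
    exact hA' κ
  · exact ⟨⟨0, hn⟩, fun d _ hd => (hex ⟨d, hd⟩).elim⟩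

theorem mul_pow_mem {b : ℕ} (hb : 2 ≤ b) {f : ℕ → ℕ} (hf : ∀ i, f i < b) (k : ℕ) :
    (((digitPrefix b f k : ℕ) : ℤ) : ℝ) ≤ digitVal b f * (b : ℝ) ^ k ∧
      digitVal b f * (b : ℝ) ^ k ≤ ((digitPrefix b f k : ℕ) : ℤ) + 1 := by
  rw [Int.cast_natCast]
  exact ⟨digitPrefix_le hb hf k, le_digitPrefix_add_one hb hf k⟩

/-- The vertical block index `q` is constant along the chain because the digit j₀ never occurs at
position l. This fixes the forbidden pair of x-digits, so the horizontal block index, for blocks of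
n ^ 2 intervals, is constant as well. -/
theorem dist_le_of_chain_of_scales (hm : 2 ≤ m) (hn : 2 ≤ n) (hs : numRows A < m)
    (ht : maxRow A < n) {ε : ℝ} {κ l : ℕ} (hκl : κ + 2 ≤ l) (hκ : ε * (n : ℝ) ^ (κ + 2) ≤ 1)
    (hl : ε * (m : ℝ) ^ (l + 1) ≤ 1) {x y : carpet A}
    (hxy : Relation.ReflTransGen (fun a b => dist a b < ε) x y) :
    |x.1 0 - y.1 0| * (n : ℝ) ^ (κ + 2) ≤ n ^ 2 ∧ |x.1 1 - y.1 1| * (m : ℝ) ^ (l + 1) ≤ m := by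
  have hn' : (0 : ℝ) < n := by exact_mod_cast (show 0 < n by omega)
  have hm' : (0 : ℝ) < m := by exact_mod_cast (show 0 < m by omega)
  obtain ⟨j₀, hj₀⟩ := exists_row_eq_zero hs
  choose ia hia using fun v => exists_missing_digit (A := A) (by omega) ht
    (show κ < l by omega) v
  choose ib hib using fun v => exists_missing_digit (A := A) (by omega) ht
    (show κ + 1 < l by omega) v
  choose δ hδA hδ using fun x : carpet A => mem_carpet.1 x.2
  have hX := fun x : carpet A => mul_pow_mem hn (fun i => (δ x i).1.2) (κ + 2)
  have hY := fun x : carpet A => mul_pow_mem hm (fun i => (δ x i).2.2) (l + 1)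
  have h0 : ∀ x : carpet A, digitVal n (fun i => (δ x i).1) = x.1 0 := fun x => by
    rw [hδ x]; rfl
  have h1 : ∀ x : carpet A, digitVal m (fun i => (δ x i).2) = x.1 1 := fun x => by
    rw [hδ x]; rfl
  simp only [h0] at hX
  simp only [h1] at hY
  let NX : carpet A → ℤ := fun x => digitPrefix n (fun i => (δ x i).1) (κ + 2)
  let NY : carpet A → ℤ := fun x => digitPrefix m (fun i => (δ x i).2) (l + 1)
  let q : carpet A → ℤ := fun x => (NY x - (j₀ : ℕ)) / m
  -- The forbidden pair: its digit at position κ is missing when the y-prefix is v, its digit at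
  -- position κ + 1 when the y-prefix is v + 1.
  let ρ : ℤ → ℤ := fun v => (ia v : ℕ) * n + (ib (v + 1) : ℕ)
  have hmZ : (0 : ℤ) < m := by omega
  have hnZ : (0 : ℤ) < (n : ℤ) ^ 2 := by positivity
  have hrow : ∀ x i, (δ x i).2 ≠ j₀ := fun x i h =>
    rowCount_ne_zero.2 ⟨(δ x i).1, hδA x i⟩ (h ▸ hj₀)
  have hNY : ∀ x, NY x = m * (digitPrefix m (fun i => (δ x i).2) l : ℤ) + ((δ x l).2 : ℕ) :=
    fun x => by simp [NY, digitPrefix]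
  have hjm : ((j₀ : ℕ) : ℤ) < m := by have := j₀.2; omega
  have hgm : ∀ x, (((δ x l).2 : ℕ) : ℤ) < m := fun x => by have := (δ x l).2.2; omega
  have hgj : ∀ x, (((δ x l).2 : ℕ) : ℤ) ≠ (j₀ : ℕ) := fun x h =>
    hrow x l (Fin.ext (by exact_mod_cast h))
  -- A block starts at the row j₀ of one y-prefix and ends below the row j₀ of the next: last digits
  -- above j₀ belong to the prefix q, those below it to q + 1.
  have hq : ∀ x, (NY x - (j₀ : ℕ)) % m ≠ 0 ∧
      ((digitPrefix m (fun i => (δ x i).2) l : ℤ) = q x ∨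
        (digitPrefix m (fun i => (δ x i).2) l : ℤ) = q x + 1) := by
    intro x
    set Y : ℤ := (digitPrefix m (fun i => (δ x i).2) l : ℤ)
    have := hgm x
    have := hgj x
    rcases lt_or_ge (((δ x l).2 : ℕ) : ℤ) (j₀ : ℕ) with hlt | hge
    · have e : NY x - (j₀ : ℕ) = ((δ x l).2 : ℕ) - (j₀ : ℕ) + m + m * (Y - 1) := by
        rw [hNY]; ring
      simp only [q]
      rw [e, Int.add_mul_emod_self_left, Int.add_mul_ediv_left _ _ hmZ.ne',
        Int.emod_eq_of_lt (by omega) (by omega), Int.ediv_eq_zero_of_lt (by omega) (by omega)]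
      omega
    · have e : NY x - (j₀ : ℕ) = ((δ x l).2 : ℕ) - (j₀ : ℕ) + m * Y := by
        rw [hNY]; ring
      simp only [q]
      rw [e, Int.add_mul_emod_self_left, Int.add_mul_ediv_left _ _ hmZ.ne',
        Int.emod_eq_of_lt (by omega) (by omega), Int.ediv_eq_zero_of_lt (by omega) (by omega)]
      omega
  have hρ : ∀ x, (NX x - ρ (q x)) % (n : ℤ) ^ 2 ≠ 0 := by
    intro x h
    have e : NX x - ρ (q x) = n * (((δ x κ).1 : ℕ) - (ia (q x) : ℕ)) +
        (((δ x (κ + 1)).1 : ℕ) - (ib (q x + 1) : ℕ)) +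
          (n : ℤ) ^ 2 * digitPrefix n (fun i => (δ x i).1) κ := by
      simp [NX, ρ, digitPrefix]
      ring
    rw [e, Int.add_mul_emod_self_left] at h
    have b1 := (δ x κ).1.2
    have b2 := (δ x (κ + 1)).1.2
    have b3 := (ia (q x)).2
    have b4 := (ib (q x + 1)).2
    set u : ℤ := ((δ x κ).1 : ℕ) - (ia (q x) : ℕ) with hu
    set w : ℤ := ((δ x (κ + 1)).1 : ℕ) - (ib (q x + 1) : ℕ) with hw
    have hdvd : (n : ℤ) ^ 2 ∣ n * u + w := Int.dvd_of_emod_eq_zero h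
    have hw0 : w = 0 := by
      have h1 : (n : ℤ) ∣ w := (Int.dvd_add_right (dvd_mul_right _ _)).1
        ((dvd_pow_self _ two_ne_zero).trans hdvd)
      exact Int.eq_zero_of_abs_lt_dvd h1 (by rw [abs_lt]; constructor <;> omega)
    have hu0 : u = 0 := by
      rw [hw0, add_zero, sq] at hdvd
      have h1 : (n : ℤ) ∣ u := Int.dvd_of_mul_dvd_mul_left (by omega) hdvd
      exact Int.eq_zero_of_abs_lt_dvd h1 (by rw [abs_lt]; constructor <;> omega)
    rcases (hq x).2 with hv | hv
    · exact hia _ (δ x) (hδA x) hv (Fin.ext (by omega))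
    · exact hib _ (δ x) (hδA x) hv (Fin.ext (by omega))
  have hstep : ∀ a b : carpet A, dist a b < ε →
      q a = q b ∧ (NX a - ρ (q a)) / (n : ℤ) ^ 2 = (NX b - ρ (q b)) / (n : ℤ) ^ 2 := by
    intro a b hab
    have d0 : |a.1 0 * (n : ℝ) ^ (κ + 2) - b.1 0 * (n : ℝ) ^ (κ + 2)| < 1 := by
      rw [← sub_mul, abs_mul, abs_of_pos (a := (n : ℝ) ^ (κ + 2)) (by positivity)]
      exact (mul_lt_mul_of_pos_right ((abs_coord_sub_le_dist a.1 b.1 0).trans_lt hab)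
        (by positivity)).trans_le hκ
    have d1 : |a.1 1 * (m : ℝ) ^ (l + 1) - b.1 1 * (m : ℝ) ^ (l + 1)| < 1 := by
      rw [← sub_mul, abs_mul, abs_of_pos (a := (m : ℝ) ^ (l + 1)) (by positivity)]
      exact (mul_lt_mul_of_pos_right ((abs_coord_sub_le_dist a.1 b.1 1).trans_lt hab)
        (by positivity)).trans_le hl
    have hqq : q a = q b := ediv_eq_of_abs_sub_lt_one hmZ (hY a).1 (hY a).2 (hY b).1 (hY b).2 d1
      (hq a).1 (hq b).1
    refine ⟨hqq, ?_⟩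
    have hb := hρ b
    rw [← hqq] at hb ⊢
    exact ediv_eq_of_abs_sub_lt_one hnZ (hX a).1 (hX a).2 (hX b).1 (hX b).2 d0 (hρ a) hb
  have hchain : q x = q y ∧ (NX x - ρ (q x)) / (n : ℤ) ^ 2 = (NX y - ρ (q y)) / (n : ℤ) ^ 2 := by
    induction hxy with
    | refl => exact ⟨rfl, rfl⟩
    | tail _ hbc ih => exact ⟨ih.1.trans (hstep _ _ hbc).1, ih.2.trans (hstep _ _ hbc).2⟩
  constructor
  · rw [← abs_of_pos (a := (n : ℝ) ^ (κ + 2)) (by positivity), ← abs_mul, sub_mul]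
    have := hchain.2
    rw [← hchain.1] at this
    exact_mod_cast abs_sub_le_of_ediv_eq hnZ (hX x).1 (hX x).2 (hX y).1 (hX y).2 this
  · rw [← abs_of_pos (a := (m : ℝ) ^ (l + 1)) (by positivity), ← abs_mul, sub_mul]
    exact_mod_cast abs_sub_le_of_ediv_eq hmZ (hY x).1 (hY x).2 (hY y).1 (hY y).2 hchain.1

theorem dist_le_of_chain (hm : 2 ≤ m) (hmn : m < n) (hs : numRows A < m) (ht : maxRow A < n)
    {ε : ℝ} (hε : 0 < ε) {x y : carpet A}
    (hxy : Relation.ReflTransGen (fun a b => dist a b < ε) x y) :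
    dist x y ≤ ((n : ℝ) ^ 4 + (m : ℝ) ^ 2 + 2 * (n : ℝ) ^ 3) * ε := by
  have hn : 2 ≤ n := by omega
  have hn' : (0 : ℝ) < n := by exact_mod_cast (show 0 < n by omega)
  have hm' : (0 : ℝ) < m := by exact_mod_cast (show 0 < m by omega)
  have p1 : 0 < (n : ℝ) ^ 4 * ε := by positivity
  have p2 : 0 < (m : ℝ) ^ 2 * ε := by positivity
  have p3 : 0 < (n : ℝ) ^ 3 * ε := by positivity
  -- For large ε the diameter bound 2 suffices, which is the role of 2 n ^ 3 in the constant.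
  -- Otherwise the scale of ε in base n is at least 3, leaving room for κ + 2 ≤ l.
  rcases lt_or_ge 1 ((n : ℝ) ^ 3 * ε) with hbig | hsmall
  · have := dist_carpet_le_two hn hm x y
    linarith
  obtain ⟨κ, hκ⟩ := exists_isScale hn p3 hsmall
  have hκ' : IsScale n ε (κ + 3) := by
    constructor
    · rw [pow_add, mul_inv, ← div_eq_mul_inv, le_div_iff₀ (by positivity)]
      linarith [hκ.1]
    · rw [show κ + 3 + 1 = κ + 1 + 3 by ring, pow_add, mul_inv, ← div_eq_mul_inv,
        div_lt_iff₀ (by positivity)]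
      linarith [hκ.2]
  have hε1 : ε ≤ 1 := hκ'.1.trans (inv_le_one_of_one_le₀ (one_le_pow₀ (by
    exact_mod_cast (show 1 ≤ n by omega))))
  obtain ⟨L, hL⟩ := exists_isScale hm hε hε1
  have hκL := hκ'.le_of_base_le hm hmn.le hL
  obtain ⟨l, rfl⟩ : ∃ l, L = l + 1 := ⟨L - 1, by omega⟩
  have hκ'' : ε * (n : ℝ) ^ (κ + 2) ≤ 1 := by
    calc ε * (n : ℝ) ^ (κ + 2) ≤ ε * (n : ℝ) ^ (κ + 3) := by
          gcongr
          · exact_mod_cast (show 1 ≤ n by omega)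
          · omega
      _ ≤ 1 := by rw [← le_div_iff₀ (by positivity), one_div]; exact hκ'.1
  have hL'' : ε * (m : ℝ) ^ (l + 1) ≤ 1 := by
    rw [← le_div_iff₀ (by positivity), one_div]
    exact hL.1
  obtain ⟨d0, d1⟩ := dist_le_of_chain_of_scales hm hn hs ht (κ := κ) (l := l) (by omega) hκ'' hL'' hxy
  have e0 : |x.1 0 - y.1 0| ≤ (n : ℝ) ^ 4 * ε := by
    have h1 := hκ.2.le
    rw [← one_div, div_le_iff₀ (by positivity)] at h1
    rw [pow_add] at d0
    have h2 : |x.1 0 - y.1 0| * (n : ℝ) ^ κ ≤ 1 := by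
      have : (0 : ℝ) < (n : ℝ) ^ 2 := by positivity
      nlinarith
    have h3 : |x.1 0 - y.1 0| * (n : ℝ) ^ κ ≤ (n : ℝ) ^ 4 * ε * (n : ℝ) ^ κ :=
      h2.trans (h1.trans (le_of_eq (by ring)))
    exact le_of_mul_le_mul_right h3 (by positivity)
  have e1 : |x.1 1 - y.1 1| ≤ (m : ℝ) ^ 2 * ε := by
    have h1 := hL.2.le
    rw [← one_div, div_le_iff₀ (by positivity)] at h1
    have h3 : |x.1 1 - y.1 1| * (m : ℝ) ^ (l + 1) ≤ (m : ℝ) ^ 2 * ε * (m : ℝ) ^ (l + 1) := by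
      refine d1.trans ?_
      calc (m : ℝ) = m * 1 := by ring
        _ ≤ m * (ε * (m : ℝ) ^ (l + 1 + 1)) := by gcongr
        _ = _ := by ring
    exact le_of_mul_le_mul_right h3 (by positivity)
  have := dist_le_abs_coord_sub_add x.1 y.1
  rw [Subtype.dist_eq]
  linarith

theorem conformalAssouadDim_carpet_eq_zero (hm : 2 ≤ m) (hmn : m < n) (hA : A.Nonempty)
    (hs : numRows A < m) (ht : maxRow A < n) : conformalAssouadDim (carpet A) = 0 := by
  obtain ⟨C, hC, hcov⟩ := exists_covers_carpet hm hmn hA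
  have hQ : 0 ≤ carpetDim A := add_nonneg (logb_natCast_nonneg (by omega) (one_le_maxRow hA))
    (logb_natCast_nonneg hm (one_le_numRows hA))
  have hn' : (1 : ℝ) ≤ n := by exact_mod_cast (show 1 ≤ n by omega)
  refine conformalAssouadDim_eq_zero_of_chain (by linarith) hQ hcov ?_
    fun ε hε x y h => dist_le_of_chain hm hmn hs ht hε h
  have h1 : (1 : ℝ) ≤ (n : ℝ) ^ 4 := one_le_pow₀ hn'
  have h2 : (0 : ℝ) ≤ (m : ℝ) ^ 2 + 2 * (n : ℝ) ^ 3 := by positivity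
  linarith

end Disconnected

/-! ### Families of discrete curves bound the dimension of quasi-symmetric images from below -/

section LowerBound

/-- A ball of radius `rad` contains at most one point of the family. The large radius is 2 `dist a
w`, so that the points a and w themselves witness the diameter restriction in `CoversAtRate`. -/
theorem card_le_of_separated {Y : Type v} [MetricSpace Y] {α C : ℝ} (hcov : CoversAtRate Y α C)
    {ι : Type*} (s : Finset ι) (q : ι → Y) {a w : Y} {rad : ℝ} (hrad : 0 < rad)
    (hle : rad ≤ dist a w) (hball : ∀ i ∈ s, dist (q i) a ≤ dist a w)
    (hsep : ∀ i ∈ s, ∀ j ∈ s, i ≠ j → 2 * rad ≤ dist (q i) (q j)) :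
    (s.card : ℝ) ≤ C * (2 * dist a w / rad) ^ α := by
  have hdiam : ENNReal.ofReal (2 * dist a w / 2) ≤ Metric.ediam (Set.univ : Set Y) := by
    rw [mul_div_cancel_left₀ _ two_ne_zero, ← edist_dist]
    exact Metric.edist_le_ediam_of_mem (Set.mem_univ a) (Set.mem_univ w)
  obtain ⟨F, hF, hsub⟩ := hcov a rad (2 * dist a w) hrad (by linarith) hdiam
  have hex : ∀ i ∈ s, ∃ y ∈ F, dist (q i) y < rad := by
    intro i hi
    have h1 : q i ∈ Metric.ball a (2 * dist a w) := by
      rw [Metric.mem_ball]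
      linarith [hball i hi]
    simpa using hsub h1
  have : Nonempty Y := ⟨a⟩
  choose! g hg hgd using hex
  refine (Nat.cast_le.2 (Finset.card_le_card_of_injOn g hg fun i hi j hj hij => ?_)).trans hF
  by_contra hne
  have h1 := hsep i hi j hj hne
  have h2 := dist_triangle_right (q i) (q j) (g i)
  have h3 := hgd i hi
  have h4 := hgd j hj
  rw [← hij] at h4
  linarith

/-- The terms are sorted by dyadic size. Those of relative size about 2 ^ (-j) belong to points
separated at that scale, so there are O(2 ^ (jα)) of them, contributing O(2 ^ (j(α - Q))). Only
levels j ≥ j₀ occur, and the geometric series converges as α < Q. -/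
theorem sum_rpow_le_of_covers {Y : Type v} [MetricSpace Y] {α C E Q : ℝ}
    (hcov : CoversAtRate Y α C) (hαQ : α < Q) (hα : 0 < α) (hC : 0 < C) (hE : 1 ≤ E)
    {ι : Type*} (s : Finset ι) (q : ι → Y) (e : ι → ℝ) {a w : Y}
    (haw : a ≠ w) (hball : ∀ i ∈ s, dist (q i) a ≤ dist a w) (he : ∀ i ∈ s, 0 < e i)
    (hsep : ∀ i ∈ s, ∀ j ∈ s, i ≠ j → e i ≤ E * dist (q i) (q j)) {j₀ : ℕ}
    (hsmall : ∀ i ∈ s, e i / dist a w ≤ ((2 : ℝ) ^ j₀)⁻¹) :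
    ∑ i ∈ s, (e i / dist a w) ^ Q ≤
      C * (8 * E) ^ α * (((2 : ℝ) ^ (α - Q)) ^ j₀ / (1 - (2 : ℝ) ^ (α - Q))) := by
  classical
  have hρ : 0 < dist a w := dist_pos.2 haw
  have hu : ∀ i ∈ s, 0 < e i / dist a w := fun i hi => div_pos (he i hi) hρ
  have hlev : ∀ i ∈ s, ∃ j, IsScale 2 (e i / dist a w) j := fun i hi =>
    exists_isScale le_rfl (hu i hi)
      ((hsmall i hi).trans (inv_le_one_of_one_le₀ (one_le_pow₀ (by norm_num))))
  choose! lev hlev using hlev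
  simp only [IsScale, Nat.cast_ofNat] at hlev
  have hj₀ : ∀ i ∈ s, j₀ ≤ lev i := by
    intro i hi
    have h := (hlev i hi).2.trans_le (hsmall i hi)
    rw [inv_lt_inv₀ (by positivity) (by positivity),
      pow_lt_pow_iff_right₀ (by norm_num : (1 : ℝ) < 2)] at h
    omega
  have hmaps : ∀ i ∈ s, lev i ∈ Finset.Ico j₀ (s.sup lev + 1) := fun i hi =>
    Finset.mem_Ico.2 ⟨hj₀ i hi, Nat.lt_succ_of_le (Finset.le_sup hi)⟩
  have hθ0 : 0 < (2 : ℝ) ^ (α - Q) := by positivity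
  have hθ1 : (2 : ℝ) ^ (α - Q) < 1 := Real.rpow_lt_one_of_one_lt_of_neg (by norm_num) (by linarith)
  have hlevel : ∀ j, ∑ i ∈ s with lev i = j, (e i / dist a w) ^ Q ≤
      C * (8 * E) ^ α * ((2 : ℝ) ^ (α - Q)) ^ j := by
    intro j
    have h1 : ∀ i ∈ s.filter (lev · = j), (e i / dist a w) ^ Q ≤ (((2 : ℝ) ^ j)⁻¹) ^ Q := by
      intro i hi
      rw [Finset.mem_filter] at hi
      have := (hlev i hi.1).1
      rw [hi.2] at this
      exact Real.rpow_le_rpow (hu i hi.1).le this (by linarith)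
    refine (Finset.sum_le_card_nsmul _ _ _ h1).trans ?_
    rw [nsmul_eq_mul]
    -- Half the separation that `hsep` provides for terms of relative size greater than 2 ^ (-(j +
    -- 1)).
    set rad := dist a w * (((2 : ℝ) ^ (j + 1))⁻¹ / (2 * E)) with hrad
    have hfac : ((2 : ℝ) ^ (j + 1))⁻¹ / (2 * E) ≤ 1 := by
      rw [div_le_one (by positivity)]
      have : ((2 : ℝ) ^ (j + 1))⁻¹ ≤ 1 := inv_le_one_of_one_le₀ (one_le_pow₀ (by norm_num))
      linarith
    have hcard := card_le_of_separated hcov (s.filter (lev · = j)) q (a := a) (w := w) (rad := rad)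
      (by positivity) (mul_le_of_le_one_right hρ.le hfac)
      (fun i hi => hball i (Finset.mem_filter.1 hi).1) (by
        intro i hi i' hi' hne
        rw [Finset.mem_filter] at hi hi'
        have h2 := hsep i hi.1 i' hi'.1 hne
        have h3 := (hlev i hi.1).2
        rw [hi.2, lt_div_iff₀ hρ] at h3
        have h4 : 2 * rad = ((2 : ℝ) ^ (j + 1))⁻¹ * dist a w / E := by
          rw [hrad]
          field_simp
        rw [h4, div_le_iff₀' (by positivity)]
        linarith)
    have h5 : 2 * dist a w / rad = 8 * E * (2 : ℝ) ^ j := by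
      rw [hrad, pow_succ]
      field_simp
      norm_num
    rw [h5, Real.mul_rpow (by positivity) (by positivity)] at hcard
    calc _ ≤ C * ((8 * E) ^ α * ((2 : ℝ) ^ j) ^ α) * (((2 : ℝ) ^ j)⁻¹) ^ Q := by gcongr
      _ = C * (8 * E) ^ α * ((2 : ℝ) ^ (α - Q)) ^ j := by
        rw [← Real.rpow_natCast ((2 : ℝ) ^ (α - Q)), ← Real.rpow_mul (by norm_num),
          Real.inv_rpow (by positivity), ← Real.rpow_neg (by positivity),
          ← Real.rpow_natCast (2 : ℝ) j, ← Real.rpow_mul (by norm_num),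
          ← Real.rpow_mul (by norm_num), mul_assoc, mul_assoc, mul_assoc,
          ← Real.rpow_add (by norm_num)]
        congr 4
        ring
  rw [← Finset.sum_fiberwise_of_maps_to hmaps]
  refine (Finset.sum_le_sum fun j _ => hlevel j).trans ?_
  rw [← Finset.mul_sum]
  gcongr
  exact geom_sum_Ico_le_of_lt_one hθ0.le hθ1

/-- A decreasing map would be bounded by its value at 0, contrary to surjectivity. -/
theorem homeomorph_strictMono (η : ℝ≥0 ≃ₜ ℝ≥0) : StrictMono η ∧ η 0 = 0 := by
  have h0 : ∃ x, η x = 0 := η.surjective 0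
  obtain ⟨x, hx⟩ := h0
  rcases Continuous.strictMono_of_inj η.continuous η.injective with h | h
  · exact ⟨h, le_antisymm ((h.monotone (zero_le (a := x))).trans hx.le) bot_le⟩
  · obtain ⟨y, hy⟩ := η.surjective (η 0 + 1)
    have h1 : η y ≤ η 0 := h.antitone (zero_le (a := y))
    rw [hy] at h1
    exact absurd h1 (not_le.2 (lt_add_one _))

/-- `X` contains a family of pairwise separated discrete curves with `M` steps of size about `r`
and length about `M r`, in a ball of radius about `M r`, of cardinality at least about `M ^ D`. -/
def HasChainGrid (X : Type u) [MetricSpace X] (H D : ℝ) (M : ℕ) : Prop :=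
  ∃ (κ : Type) (_ : Fintype κ) (p : ℕ → κ → X) (r : ℝ), 0 < r ∧ Nonempty κ ∧
    (∀ i < M, ∀ z, dist (p i z) (p (i + 1) z) ≤ H * r) ∧
    (∀ i ≤ M, ∀ i' ≤ M, ∀ z z', (i, z) ≠ (i', z') → r ≤ dist (p i z) (p i' z')) ∧
    (∀ z, M * r ≤ H * dist (p 0 z) (p M z)) ∧
    (∀ i ≤ M, ∀ i' ≤ M, ∀ z z', dist (p i z) (p i' z') ≤ H * (M * r)) ∧
    (M : ℝ) ^ D ≤ H * Fintype.card κ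

/-- The length–volume comparison. By quasi-symmetry every image curve has length at least a fixed
multiple of ρ, so the sum of all relative steps is at least a multiple of the number of curves.
Hölder's inequality turns this into a lower bound for the sum of their (1 + D)-th powers, and
`sum_rpow_le_of_covers` bounds that sum above. -/
theorem one_le_of_hasChainGrid {X : Type u} {Y : Type v} [MetricSpace X] [MetricSpace Y]
    {f : X ≃ₜ Y} {η : ℝ≥0 ≃ₜ ℝ≥0}
    (hη : ∀ (x a b : X) (t : ℝ≥0), dist x a ≤ t * dist x b →
      dist (f x) (f a) ≤ η t * dist (f x) (f b))
    {H : ℝ≥0} {D α C : ℝ} (hD : 0 ≤ D) (hα : 0 < α) (hC : 0 < C)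
    (hcov : CoversAtRate Y α C) (hαD : α < 1 + D) {M : ℕ} (hM : 1 ≤ M)
    (hgrid : HasChainGrid X H D M) {j₀ : ℕ} (hj₀ : η (2 * H ^ 2 / M) * 2 ≤ ((2 : ℝ≥0) ^ j₀)⁻¹) :
    1 ≤ (2 * (η (H ^ 2) : ℝ)) ^ (1 + D) * H * (C * (8 * (η H + 1 : ℝ)) ^ α *
      (((2 : ℝ) ^ (α - (1 + D))) ^ j₀ / (1 - (2 : ℝ) ^ (α - (1 + D))))) := by
  classical
  obtain ⟨κ, _, p, r, hr, ⟨z₀⟩, hstep, hsep, hends, hdiam, hcard⟩ := hgrid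
  have hM' : (1 : ℝ) ≤ M := by exact_mod_cast hM
  let G : Finset (ℕ × κ) := Finset.range (M + 1) ×ˢ Finset.univ
  have hG : ∀ {x : ℕ × κ}, x ∈ G ↔ x.1 ≤ M := fun {x} => by
    simp [G]
  set a : Y := f (p 0 z₀) with ha
  obtain ⟨x₁, hx₁, hmax⟩ := Finset.exists_max_image G (fun x => dist (f (p x.1 x.2)) a)
    ⟨(0, z₀), hG.2 (Nat.zero_le _)⟩
  set w : Y := f (p x₁.1 x₁.2) with hw
  set ρ := dist a w with hρdef
  have hin : ∀ i ≤ M, ∀ z, dist (f (p i z)) a ≤ ρ := fun i hi z => by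
    rw [hρdef, dist_comm a w]
    exact hmax (i, z) (hG.2 hi)
  have hne : ∀ i ≤ M, ∀ i' ≤ M, ∀ z z', (i, z) ≠ (i', z') → 0 < dist (f (p i z)) (f (p i' z')) := by
    intro i hi i' hi' z z' h
    refine dist_pos.2 fun heq => ?_
    have := hsep i hi i' hi' z z' h
    rw [f.injective heq, dist_self] at this
    linarith
  have hρ : 0 < ρ := (hne M le_rfl 0 (Nat.zero_le _) z₀ z₀ (by simp; omega)).trans_le
    (hin M le_rfl z₀)
  have hlen : ∀ z, ρ ≤ 2 * η (H ^ 2) * dist (f (p 0 z)) (f (p M z)) := by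
    intro z
    have hto : ∀ i ≤ M, ∀ z', dist (f (p 0 z)) (f (p i z')) ≤
        η (H ^ 2) * dist (f (p 0 z)) (f (p M z)) := by
      intro i hi z'
      refine hη _ _ _ _ ((hdiam 0 (Nat.zero_le _) i hi z z').trans ?_)
      push_cast
      rw [sq, mul_assoc]
      exact mul_le_mul_of_nonneg_left (hends z) H.2
    have h1 := hto 0 (Nat.zero_le _) z₀
    have h2 := hto x₁.1 (hG.1 hx₁) x₁.2
    have h3 := dist_triangle_left a w (f (p 0 z))
    linarith
  have hfar : ∀ i < M, ∀ z, dist (f (p i z)) (f (p (i + 1) z)) / ρ ≤ ((2 : ℝ) ^ j₀)⁻¹ := by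
    intro i hi z
    -- One of the two ends of the curve is at least half the distance between the ends away from the
    -- given point.
    have hex : ∃ b ≤ M, (M : ℝ) * r ≤ 2 * H * dist (p i z) (p b z) := by
      by_contra! hall
      have h1 := hall 0 (Nat.zero_le _)
      have h2 := hall M le_rfl
      have h3 := dist_triangle_left (p 0 z) (p M z) (p i z)
      have h4 := mul_le_mul_of_nonneg_left h3 H.2
      have h5 := hends z
      change (H : ℝ) * _ ≤ H * _ at h4
      linarith
    obtain ⟨b, hb, hbd⟩ := hex
    have h1 : dist (p i z) (p (i + 1) z) ≤ (2 * H ^ 2 / M : ℝ≥0) * dist (p i z) (p b z) := by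
      refine (hstep i hi z).trans ?_
      push_cast
      rw [div_mul_eq_mul_div, le_div_iff₀ (by positivity)]
      calc (H : ℝ) * r * M = H * (M * r) := by ring
        _ ≤ H * (2 * H * dist (p i z) (p b z)) := mul_le_mul_of_nonneg_left hbd H.2
        _ = _ := by ring
    have h2 := hη _ _ _ _ h1
    have h3 : dist (f (p i z)) (f (p b z)) ≤ 2 * ρ := by
      have := dist_triangle_right (f (p i z)) (f (p b z)) a
      have := hin i hi.le z
      have := hin b hb z
      linarith
    have h4 : (η (2 * H ^ 2 / M) : ℝ) * 2 ≤ ((2 : ℝ) ^ j₀)⁻¹ := by exact_mod_cast hj₀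
    rw [div_le_iff₀ hρ]
    calc _ ≤ _ := h2
      _ ≤ (η (2 * H ^ 2 / M) : ℝ) * (2 * ρ) := by gcongr
      _ = (η (2 * H ^ 2 / M) : ℝ) * 2 * ρ := by ring
      _ ≤ _ := by gcongr
  let s : Finset (ℕ × κ) := Finset.range M ×ˢ Finset.univ
  have hs : ∀ {x : ℕ × κ}, x ∈ s → x.1 < M := fun {x} hx => by
    simpa [s] using hx
  let e : ℕ × κ → ℝ := fun x => dist (f (p x.1 x.2)) (f (p (x.1 + 1) x.2))
  -- Quasi-symmetry compares an image step with the distance to any other grid point, giving the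
  -- factor η(H); the added 1 ensures E ≥ 1.
  have hupper := sum_rpow_le_of_covers (E := η H + 1) hcov hαD hα hC
    (le_add_of_nonneg_left (η H).2) s (fun x => f (p x.1 x.2)) e (a := a) (w := w)
    (dist_pos.1 hρ) (fun x hx => hin x.1 (hs hx).le x.2)
    (fun x hx => hne _ (hs hx).le _ (hs hx) _ _ fun h => by simpa using congrArg Prod.fst h)
    (fun x hx y hy hxy => by
      have h1 := hsep x.1 (hs hx).le y.1 (hs hy).le x.2 y.2 hxy
      have h2 : dist (f (p x.1 x.2)) (f (p (x.1 + 1) x.2)) ≤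
          η H * dist (f (p x.1 x.2)) (f (p y.1 y.2)) :=
        hη _ _ _ _ ((hstep _ (hs hx) _).trans (mul_le_mul_of_nonneg_left h1 H.2))
      refine h2.trans ?_
      gcongr
      linarith)
    (j₀ := j₀) (fun x hx => hfar _ (hs hx) _)
  have hsum : (Fintype.card κ : ℝ) ≤ 2 * η (H ^ 2) * ∑ x ∈ s, e x / ρ := by
    have h1 : ∀ z, ρ ≤ 2 * η (H ^ 2) * ∑ i ∈ Finset.range M, e (i, z) := fun z =>
      (hlen z).trans (by gcongr; exact dist_le_range_sum_dist (fun i => f (p i z)) M)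
    have h2 : (Fintype.card κ : ℝ) * ρ ≤ 2 * η (H ^ 2) * ∑ x ∈ s, e x := by
      rw [Finset.sum_product_right, Finset.mul_sum, ← nsmul_eq_mul]
      exact Finset.card_nsmul_le_sum Finset.univ _ ρ fun z _ => h1 z
    rw [← Finset.sum_div, ← mul_div_assoc, le_div_iff₀ hρ]
    exact h2
  have hK : (0 : ℝ) < Fintype.card κ := by
    exact_mod_cast Fintype.card_pos_iff.2 ⟨z₀⟩
  have hMpos : (0 : ℝ) < M := by linarith
  have hholder : (∑ x ∈ s, e x / ρ) ^ (1 + D) ≤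
      ((M : ℝ) * Fintype.card κ) ^ D * ∑ x ∈ s, (e x / ρ) ^ (1 + D) := by
    have h := Real.rpow_sum_le_const_mul_sum_rpow_of_nonneg (s := s) (f := fun x => e x / ρ)
      (p := 1 + D) (by linarith) (fun x _ => div_nonneg dist_nonneg hρ.le)
    have hc : (s.card : ℝ) = M * Fintype.card κ := by simp [s]
    rwa [hc, add_sub_cancel_left] at h
  set S := ∑ x ∈ s, (e x / ρ) ^ (1 + D) with hS
  have hS0 : 0 ≤ S := Finset.sum_nonneg fun x _ =>
    Real.rpow_nonneg (div_nonneg dist_nonneg hρ.le) _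
  have hT0 : 0 ≤ ∑ x ∈ s, e x / ρ := Finset.sum_nonneg fun x _ => div_nonneg dist_nonneg hρ.le
  have hη0 : (0 : ℝ) ≤ 2 * η (H ^ 2) := by positivity
  -- The cardinality condition M ^ D ≤ H |κ| enters here: it makes the powers of |κ| on both sides
  -- equal, so they cancel.
  have h1 : (Fintype.card κ : ℝ) ^ (1 + D) ≤
      (2 * η (H ^ 2)) ^ (1 + D) * (((H : ℝ) * Fintype.card κ) * (Fintype.card κ : ℝ) ^ D * S) := by
    calc (Fintype.card κ : ℝ) ^ (1 + D) ≤ (2 * η (H ^ 2) * ∑ x ∈ s, e x / ρ) ^ (1 + D) := by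
          gcongr
      _ = (2 * η (H ^ 2)) ^ (1 + D) * (∑ x ∈ s, e x / ρ) ^ (1 + D) := Real.mul_rpow hη0 hT0
      _ ≤ (2 * η (H ^ 2)) ^ (1 + D) * (((M : ℝ) * Fintype.card κ) ^ D * S) := by gcongr
      _ ≤ _ := by
        rw [Real.mul_rpow hMpos.le hK.le]
        gcongr
  rw [Real.rpow_add hK, Real.rpow_one] at h1
  have h2 : (Fintype.card κ : ℝ) * (Fintype.card κ : ℝ) ^ D * 1 ≤
      (Fintype.card κ : ℝ) * (Fintype.card κ : ℝ) ^ D * ((2 * η (H ^ 2)) ^ (1 + D) * H * S) := by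
    rw [mul_one]
    exact h1.trans (le_of_eq (by ring))
  refine (le_of_mul_le_mul_left h2 (by positivity)).trans ?_
  gcongr

theorem one_add_le_of_hasChainGrid {X : Type u} {Y : Type v} [MetricSpace X] [MetricSpace Y]
    {f : X ≃ₜ Y} (hf : IsQuasisymmetric f) {H : ℝ≥0} {D α C : ℝ} (hD : 0 ≤ D) (hα : 0 < α)
    (hC : 0 < C) (hcov : CoversAtRate Y α C) (hgrid : ∀ N, ∃ M ≥ N, HasChainGrid X H D M) :
    1 + D ≤ α := by
  by_contra! hαD
  obtain ⟨η, hη⟩ := hf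
  obtain ⟨hmono, hη0⟩ := homeomorph_strictMono η
  have hθ0 : 0 < (2 : ℝ) ^ (α - (1 + D)) := by positivity
  have hθ1 : (2 : ℝ) ^ (α - (1 + D)) < 1 :=
    Real.rpow_lt_one_of_one_lt_of_neg (by norm_num) (by linarith)
  have hlim : Filter.Tendsto (fun j : ℕ => (2 * (η (H ^ 2) : ℝ)) ^ (1 + D) * H *
      (C * (8 * (η H + 1 : ℝ)) ^ α *
      (((2 : ℝ) ^ (α - (1 + D))) ^ j / (1 - (2 : ℝ) ^ (α - (1 + D)))))) Filter.atTop (nhds 0) := by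
    have := (((tendsto_pow_atTop_nhds_zero_of_lt_one hθ0.le hθ1).div_const
      (1 - (2 : ℝ) ^ (α - (1 + D)))).const_mul (C * (8 * (η H + 1 : ℝ)) ^ α)).const_mul
      ((2 * (η (H ^ 2) : ℝ)) ^ (1 + D) * H)
    simpa using this
  obtain ⟨j₀, hj₀⟩ := (hlim.eventually_lt_const zero_lt_one).exists
  have hlim2 : Filter.Tendsto (fun M : ℕ => η (2 * H ^ 2 / M) * 2) Filter.atTop (nhds 0) := by
    have h1 : Filter.Tendsto (fun M : ℕ => 2 * H ^ 2 / (M : ℝ≥0)) Filter.atTop (nhds 0) :=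
      tendsto_const_div_atTop_nhds_zero_nat _
    have h2 := ((η.continuous.tendsto 0).comp h1).mul_const 2
    simpa [hη0] using h2
  obtain ⟨N, hN⟩ := Filter.eventually_atTop.1
    (hlim2.eventually_le_const (show (0 : ℝ≥0) < ((2 : ℝ≥0) ^ j₀)⁻¹ by positivity))
  obtain ⟨M, hM, hMgrid⟩ := hgrid (max N 1)
  have := one_le_of_hasChainGrid hη hD hα hC hcov hαD ((le_max_right _ _).trans hM) hMgrid
    (hN M ((le_max_left _ _).trans hM))
  linarith

end LowerBound

/-! ### Approximate product grids inside the carpet -/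

section Grid

variable {n m : ℕ} {A : Finset (Fin n × Fin m)}

/-- The digit sequence whose `x`-digits at the positions `k, …, k + L - 1` are those of `w` and
whose `y`-digits at the positions `l, …, l + L' - 1` are those of `z`. -/
def gridDigits (a : Fin n × Fin m) (g : Fin m → Fin n) (k L l L' : ℕ) (w : ℕ → Fin n)
    (z : ℕ → Fin m) (q : ℕ) : Fin n × Fin m :=
  if q < k then a else if q < k + L then (w (q - k), a.2) else if q < l then a
  else if q < l + L' then (g (z (q - l)), z (q - l)) else a

/-- For large k the vertical depth l with m ^ l near n ^ k exceeds k + L, since m < n. Both l and l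
+ L' are integer logarithms in base m, of n ^ k and of n ^ (k + L). -/
theorem exists_scales (hm : 2 ≤ m) (hmn : m < n) (L : ℕ) :
    ∃ k l L', k + L < l ∧ m ^ (l + L') ≤ n ^ (k + L) ∧ n ^ (k + L) ≤ m * m ^ (l + L') ∧
      m ^ L' ≤ m * n ^ L ∧ n ^ L ≤ m * m ^ L' := by
  have hm' : (0 : ℝ) < m := by exact_mod_cast (show 0 < m by omega)
  obtain ⟨k, hk⟩ := pow_unbounded_of_one_lt ((m : ℝ) ^ (L + 1))
    ((one_lt_div hm').2 (show (m : ℝ) < n by exact_mod_cast hmn))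
  have hk' : m ^ (k + L + 1) ≤ n ^ k := by
    rw [div_pow, lt_div_iff₀ (by positivity), ← pow_add] at hk
    rw [add_assoc, add_comm]
    exact_mod_cast hk.le
  have hnk : n ^ k ≠ 0 := pow_ne_zero _ (by omega)
  have hnkL : n ^ (k + L) ≠ 0 := pow_ne_zero _ (by omega)
  have hl := Nat.le_log_of_pow_le (by omega) hk'
  have hmono : Nat.log m (n ^ k) ≤ Nat.log m (n ^ (k + L)) :=
    Nat.log_mono_right (Nat.pow_le_pow_right (by omega) (by omega))
  have a1 := Nat.pow_log_le_self m hnk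
  have a2 := Nat.lt_pow_succ_log_self (show 1 < m by omega) (n ^ k)
  have b1 := Nat.pow_log_le_self m hnkL
  have b2 := Nat.lt_pow_succ_log_self (show 1 < m by omega) (n ^ (k + L))
  obtain ⟨L', hL'⟩ := Nat.exists_eq_add_of_le hmono
  rw [hL'] at b1 b2
  set l := Nat.log m (n ^ k)
  have hml : 0 < m ^ l := pow_pos (by omega) _
  refine ⟨k, l, L', by omega, b1, by rw [← pow_succ']; exact b2.le, ?_, ?_⟩
  · refine Nat.le_of_mul_le_mul_left ?_ hml
    calc m ^ l * m ^ L' = m ^ (l + L') := (pow_add _ _ _).symm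
      _ ≤ n ^ k * n ^ L := by rwa [← pow_add]
      _ ≤ m ^ (l + 1) * n ^ L := Nat.mul_le_mul_right _ a2.le
      _ = m ^ l * (m * n ^ L) := by ring
  · refine Nat.le_of_mul_le_mul_left ?_ (Nat.pos_of_ne_zero hnk)
    calc n ^ k * n ^ L = n ^ (k + L) := (pow_add _ _ _).symm
      _ ≤ m ^ (l + L' + 1) := b2.le
      _ = m ^ l * (m * m ^ L') := by ring
      _ ≤ n ^ k * (m * m ^ L') := Nat.mul_le_mul_right _ a1

/-- The x-digits in one window and the y-digits in a later window of comparable scale are chosen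
independently, which gives an approximate product. The x-digits forced by the second window perturb
the first coordinate by `τ`. As k + L < l, a fixed digit precedes them, so the perturbation varies
by at most 1 / n ≤ 1 / 2 grid units. -/
theorem exists_grid (hm : 2 ≤ m) (hmn : m < n) {a : Fin n × Fin m} (ha : a ∈ A) (L : ℕ) :
    ∃ (L' : ℕ) (ux uy : ℝ) (p : (ℕ → Fin n) → (ℕ → Fin m) → EuclideanSpace ℝ (Fin 2))
      (τ : (ℕ → Fin m) → ℝ),
      0 < ux ∧ ux ≤ uy ∧ uy ≤ m * ux ∧ m ^ L' ≤ m * n ^ L ∧ n ^ L ≤ m * m ^ L' ∧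
      (∀ w z, (∀ q, (w q, a.2) ∈ A) → (∀ q, rowCount A (z q) ≠ 0) → p w z ∈ carpet A) ∧
      (∀ w z w' z', p w z 0 - p w' z' 0 = ((digitPrefix n (fun q => w q) L : ℝ) -
        digitPrefix n (fun q => w' q) L + (τ z - τ z')) * ux) ∧
      (∀ z z', |τ z - τ z'| ≤ 1 / 2) ∧
      ∀ w z w' z', p w z 1 - p w' z' 1 = ((digitPrefix m (fun q => z q) L' : ℝ) -
        digitPrefix m (fun q => z' q) L') * uy := by
  have hn : 2 ≤ n := by omega
  have hn' : (2 : ℝ) ≤ n := by exact_mod_cast hn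
  have hm' : (2 : ℝ) ≤ m := by exact_mod_cast hm
  obtain ⟨k, l, L', hkl, h1, h2, h3, h4⟩ := exists_scales hm hmn L
  have hg : ∃ g : Fin m → Fin n, ∀ j, rowCount A j ≠ 0 → (g j, j) ∈ A := by
    have : Nonempty (Fin n) := ⟨a.1⟩
    choose! g hg using fun j (h : rowCount A j ≠ 0) => rowCount_ne_zero.1 h
    exact ⟨g, hg⟩
  obtain ⟨g, hg⟩ := hg
  let d := gridDigits a g k L l L'
  let τ : (ℕ → Fin m) → ℝ := fun z =>
    digitVal n fun q => (d (fun _ => a.1) z (q + (k + L))).1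
  have h1' : (m : ℝ) ^ (l + L') ≤ (n : ℝ) ^ (k + L) := by exact_mod_cast h1
  have h2' : (n : ℝ) ^ (k + L) ≤ m * (m : ℝ) ^ (l + L') := by exact_mod_cast h2
  refine ⟨L', ((n : ℝ) ^ (k + L))⁻¹, ((m : ℝ) ^ (l + L'))⁻¹, fun w z => digitPoint (d w z), τ,
    by positivity, ?_, ?_, h3, h4, ?_, ?_, ?_, ?_⟩
  · exact inv_anti₀ (by positivity) h1'
  · rw [← div_eq_mul_inv, inv_le_comm₀ (by positivity) (by positivity), inv_div,
      div_le_iff₀' (by positivity)]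
    exact h2'
  · intro w z hw hz
    refine mem_carpet.2 ⟨d w z, fun q => ?_, rfl⟩
    simp only [d, gridDigits]
    split_ifs
    exacts [ha, hw _, ha, hg _ (hz _), ha]
  · have key : ∀ w z, (digitPoint (d w z)) 0 = ((digitPrefix n (fun _ => a.1) k * n ^ L : ℕ) +
        (digitPrefix n (fun q => w q) L : ℝ) + τ z) * ((n : ℝ) ^ (k + L))⁻¹ := by
      intro w z
      rw [← div_eq_mul_inv, eq_div_iff (by positivity)]
      change digitVal n (fun i => (d w z i).1) * _ = _
      rw [digitVal_mul_pow hn fun i => (d w z i).1.2, digitPrefix_add]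
      have e1 : digitPrefix n (fun i => (d w z i).1) k = digitPrefix n (fun _ => a.1) k :=
        digitPrefix_congr fun i hi => by simp [d, gridDigits, hi]
      have e2 : digitPrefix n (fun i => (d w z (i + k)).1) L = digitPrefix n (fun q => w q) L :=
        digitPrefix_congr fun i hi => by
          have : i + k < k + L := by omega
          simp [d, gridDigits, this]
      have e3 : (fun i => ((d w z (i + (k + L))).1 : ℕ)) =
          fun i => ((d (fun _ => a.1) z (i + (k + L))).1 : ℕ) := by
        funext i
        have h1 : ¬ i + (k + L) < k := by omega
        have h2 : ¬ i + (k + L) < k + L := by omega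
        simp only [d, gridDigits, h1, h2, if_false]
      rw [e1, e2, e3]
      push_cast
      ring
    intro w z w' z'
    rw [key, key]
    ring
  · intro z z'
    refine (abs_digitVal_sub_le hn (fun i => Fin.is_lt _) (fun i => Fin.is_lt _)
      (k := 1) fun i hi => ?_).trans ?_
    · have h1 : ¬ i + (k + L) < k := by omega
      have h2 : ¬ i + (k + L) < k + L := by omega
      have h3 : i + (k + L) < l := by omega
      simp only [d, gridDigits, h1, h2, h3, if_false, if_true]
    · rw [pow_one, one_div]
      exact inv_anti₀ (by norm_num) hn'
  · have key : ∀ w z, (digitPoint (d w z)) 1 = ((digitPrefix m (fun _ => a.2) l * m ^ L' : ℕ) +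
        (digitPrefix m (fun q => z q) L' : ℝ) + digitVal m fun _ => a.2) *
          ((m : ℝ) ^ (l + L'))⁻¹ := by
      intro w z
      rw [← div_eq_mul_inv, eq_div_iff (by positivity)]
      change digitVal m (fun i => (d w z i).2) * _ = _
      rw [digitVal_mul_pow hm fun i => (d w z i).2.2, digitPrefix_add]
      have e1 : digitPrefix m (fun i => (d w z i).2) l = digitPrefix m (fun _ => a.2) l :=
        digitPrefix_congr fun i hi => by
          simp only [d, gridDigits, hi, if_true]
          split_ifs <;> rfl
      have e2 : digitPrefix m (fun i => (d w z (i + l)).2) L' = digitPrefix m (fun q => z q) L' :=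
        digitPrefix_congr fun i hi => by
          have h1 : ¬ i + l < k := by omega
          have h2 : ¬ i + l < k + L := by omega
          have h3 : i + l < l + L' := by omega
          simp [d, gridDigits, h1, h2, h3]
      have e3 : (fun i => ((d w z (i + (l + L'))).2 : ℕ)) = fun i => (a.2 : ℕ) := by
        funext i
        have h1 : ¬ i + (l + L') < k := by omega
        have h2 : ¬ i + (l + L') < k + L := by omega
        have h3 : ¬ i + (l + L') < l := by omega
        have h4 : ¬ i + (l + L') < l + L' := by omega
        simp only [d, gridDigits, h1, h2, h3, h4, if_false]
      rw [e1, e2, e3]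
      push_cast
      ring
    intro w z w' z'
    rw [key, key]
    ring

theorem card_row (j : Fin m) : Fintype.card {i : Fin n // (i, j) ∈ A} = rowCount A j := by
  rw [Fintype.card_subtype, rowCount]
  refine Finset.card_bij (fun i _ => (i, j)) (by simp) (by simp) ?_
  rintro ⟨i, j'⟩ h
  rw [Finset.mem_filter] at h
  obtain ⟨h, rfl⟩ := h
  exact ⟨i, by simpa using h, rfl⟩

/-- The sequence that starts with the entries of `v` and continues with `c`. -/
def extendWord {b L : ℕ} {P : Fin b → Prop} (c : Fin b) (v : Fin L → {i // P i}) (q : ℕ) : Fin b :=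
  if h : q < L then v ⟨q, h⟩ else c

theorem extendWord_mem {b L : ℕ} {P : Fin b → Prop} {c : Fin b} (hc : P c)
    (v : Fin L → {i // P i}) (q : ℕ) : P (extendWord c v q) := by
  rw [extendWord]
  split_ifs
  exacts [(v _).2, hc]

theorem one_le_abs_natCast_sub {i j : ℕ} (h : i ≠ j) : (1 : ℝ) ≤ |(i : ℝ) - j| := by
  have h1 : (1 : ℤ) ≤ |(i : ℤ) - j| := Int.one_le_abs (by omega)
  exact_mod_cast h1

theorem one_le_abs_digitPrefix_sub {b L : ℕ} {P : Fin b → Prop} {c : Fin b}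
    {v v' : Fin L → {i // P i}} (h : v ≠ v') :
    (1 : ℝ) ≤ |(digitPrefix b (fun q => extendWord c v q) L : ℝ) -
      digitPrefix b (fun q => extendWord c v' q) L| := by
  refine one_le_abs_natCast_sub fun he => h (funext fun q => Subtype.ext (Fin.ext ?_))
  have := digitPrefix_inj (fun i => Fin.is_lt _) (fun i => Fin.is_lt _) he q q.2
  simpa [extendWord] using this

theorem abs_natCast_sub_le {i j M : ℕ} (hi : i ≤ M) (hj : j ≤ M) : |(i : ℝ) - j| ≤ M := by
  have hi' : (i : ℝ) ≤ M := by exact_mod_cast hi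
  have hj' : (j : ℝ) ≤ M := by exact_mod_cast hj
  rw [abs_le]
  constructor <;> linarith [(Nat.cast_nonneg i : (0 : ℝ) ≤ i), (Nat.cast_nonneg j : (0 : ℝ) ≤ j)]

/-- The base `b` digits of `i`, padded to length `L`. -/
def paddedDigits {b : ℕ} (hb : 0 < b) (L i q : ℕ) : Fin b :=
  ⟨i / b ^ (L - 1 - q) % b, Nat.mod_lt _ hb⟩

theorem exists_pow_ge (hm : 2 ≤ m) (hmn : m < n) (N : ℕ) : ∃ L, m * (N + 2) ≤ n ^ L :=
  (pow_unbounded_of_one_lt (m * (N + 2)) (show 1 < n by omega)).imp fun _ h => h.le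

/-- The bound N ≤ b ^ (e + 1) becomes q ^ (e + 1) after raising to the power log q / log b. -/
theorem rpow_le_mul_natCast_pow {b q N e K : ℕ} (hb : 2 ≤ b) (hq : 1 ≤ q) (hK : K ≤ b)
    (hN : N ≤ K * b ^ e) : (N : ℝ) ^ Real.logb b q ≤ q * (q : ℝ) ^ e := by
  have h1 := natCast_pow_eq_rpow_logb hb hq 1
  rw [pow_one, pow_one] at h1
  have h2 : (N : ℝ) ≤ b * (b : ℝ) ^ e := by exact_mod_cast hN.trans (Nat.mul_le_mul_right _ hK)
  calc (N : ℝ) ^ Real.logb b q ≤ (b * (b : ℝ) ^ e) ^ Real.logb b q :=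
        Real.rpow_le_rpow (by positivity) h2 (logb_natCast_nonneg hb hq)
    _ = q * (q : ℝ) ^ e := by
      rw [Real.mul_rpow (by positivity) (by positivity), ← natCast_pow_eq_rpow_logb hb hq, ← h1]

/-- The curves are horizontal: the full row realises every integer below n ^ L as an x-prefix, and
the curves are indexed by words of nonempty rows. Along a curve `τ` is constant. -/
theorem hasChainGrid_of_full_row (hm : 2 ≤ m) (hmn : m < n) {j : Fin m}
    (hj : ∀ i : Fin n, (i, j) ∈ A) (N : ℕ) :
    ∃ M ≥ N, HasChainGrid (carpet A) ((4 + 4 * m ^ 2 + numRows A : ℕ) : ℝ≥0)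
      (Real.logb m (numRows A)) M := by
  have hn : 0 < n := by omega
  have hjrow : rowCount A j ≠ 0 := rowCount_ne_zero.2 ⟨⟨0, hn⟩, hj _⟩
  obtain ⟨L, hL⟩ := exists_pow_ge hm hmn N
  obtain ⟨L', ux, uy, p, τ, hux, hxy, hyx, h1, h2, hmem, hx, hτ, hy⟩ :=
    exists_grid hm hmn (hj ⟨0, hn⟩) L
  have hNL : N + 2 ≤ n ^ L := (Nat.le_mul_of_pos_left _ (by omega)).trans hL
  have hM1 : ((n ^ L - 1 : ℕ) : ℝ) = (n : ℝ) ^ L - 1 := by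
    push_cast [show 1 ≤ n ^ L by omega]
    rfl
  have hW : ∀ i ≤ n ^ L - 1, digitPrefix n (fun q => paddedDigits hn L i q) L = i := fun i hi =>
    digitPrefix_div i L (by omega)
  let pt : ℕ → (Fin L' → {j // rowCount A j ≠ 0}) → carpet A := fun i z =>
    ⟨p (paddedDigits hn L i) (extendWord j z), hmem _ _ (fun q => hj _) (extendWord_mem hjrow z)⟩
  have hX : ∀ i ≤ n ^ L - 1, ∀ i' ≤ n ^ L - 1, ∀ z z', (pt i z).1 0 - (pt i' z').1 0 =
      ((i : ℝ) - i' + (τ (extendWord j z) - τ (extendWord j z'))) * ux := by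
    intro i hi i' hi' z z'
    rw [hx, hW i hi, hW i' hi']
  have hY : ∀ i i' z z', (pt i z).1 1 - (pt i' z').1 1 =
      ((digitPrefix m (fun q => extendWord j z q) L' : ℝ) -
        digitPrefix m (fun q => extendWord j z' q) L') * uy := fun i i' z z' => hy _ _ _ _
  have hux' : 0 ≤ ux := hux.le
  have huy : 0 ≤ uy := hux'.trans hxy
  have hm' : (2 : ℝ) ≤ m := by exact_mod_cast hm
  have hnL : (2 : ℝ) ≤ (n : ℝ) ^ L := by exact_mod_cast (show 2 ≤ n ^ L by omega)
  have hcard : Fintype.card (Fin L' → {j // rowCount A j ≠ 0}) = numRows A ^ L' := by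
    rw [Fintype.card_fun, Fintype.card_fin, Fintype.card_subtype, numRows]
  have hs : 1 ≤ numRows A := one_le_numRows ⟨_, hj ⟨0, hn⟩⟩
  have hs' : (0 : ℝ) ≤ numRows A := Nat.cast_nonneg _
  refine ⟨n ^ L - 1, by omega, _, inferInstance, pt, ux / 2, by positivity, ⟨fun _ => ⟨j, hjrow⟩⟩,
    fun i hi z => ?_, fun i hi i' hi' z z' hne => ?_, fun z => ?_, fun i hi i' hi' z z' => ?_, ?_⟩
  · have hd := dist_le_abs_coord_sub_add (pt i z).1 (pt (i + 1) z).1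
    rw [hX i hi.le (i + 1) hi, hY, sub_self, sub_self, zero_mul, abs_zero, add_zero, add_zero,
      abs_mul, abs_of_pos hux, Nat.cast_add_one, sub_add_cancel_left, abs_neg, abs_one] at hd
    rw [Subtype.dist_eq]
    push_cast
    nlinarith [mul_nonneg (by positivity : (0 : ℝ) ≤ 2 + 4 * m ^ 2 + numRows A) hux']
  · rw [Subtype.dist_eq]
    by_cases hz : z = z'
    · subst hz
      have hii : i ≠ i' := fun h => hne (by rw [h])
      have hd := abs_coord_sub_le_dist (pt i z).1 (pt i' z).1 0
      rw [hX _ hi _ hi', sub_self, add_zero, abs_mul, abs_of_pos hux] at hd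
      nlinarith [one_le_abs_natCast_sub hii]
    · have hd := abs_coord_sub_le_dist (pt i z).1 (pt i' z').1 1
      rw [hY, abs_mul, abs_of_nonneg huy] at hd
      nlinarith [one_le_abs_digitPrefix_sub (c := j) hz]
  · have hd := abs_coord_sub_le_dist (pt 0 z).1 (pt (n ^ L - 1) z).1 0
    rw [hX _ (Nat.zero_le _) _ le_rfl, sub_self, add_zero, abs_mul, abs_of_pos hux, Nat.cast_zero,
      zero_sub, abs_neg, Nat.abs_cast] at hd
    rw [Subtype.dist_eq]
    have h3 : (0 : ℝ) ≤ (n ^ L - 1 : ℕ) * ux := by positivity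
    have h4 : dist (pt 0 z).1 (pt (n ^ L - 1) z).1 ≤
        (4 + 4 * m ^ 2 + numRows A : ℕ) * dist (pt 0 z).1 (pt (n ^ L - 1) z).1 := by
      refine le_mul_of_one_le_left dist_nonneg ?_
      push_cast
      nlinarith
    rw [NNReal.coe_natCast]
    linarith
  · have hd := dist_le_abs_coord_sub_add (pt i z).1 (pt i' z').1
    rw [hX _ hi _ hi', hY, abs_mul, abs_mul, abs_of_pos hux, abs_of_nonneg huy] at hd
    have e1 : |(i : ℝ) - i' + (τ (extendWord j z) - τ (extendWord j z'))| ≤ n ^ L :=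
      (abs_add_le _ _).trans (by
        linarith [abs_natCast_sub_le hi hi', hτ (extendWord j z) (extendWord j z')])
    have e2 : |(digitPrefix m (fun q => extendWord j z q) L' : ℝ) -
        digitPrefix m (fun q => extendWord j z' q) L'| ≤ (m * n ^ L : ℕ) :=
      abs_natCast_sub_le ((digitPrefix_lt (fun i => Fin.is_lt _) _).le.trans h1)
        ((digitPrefix_lt (fun i => Fin.is_lt _) _).le.trans h1)
    have e3 := mul_le_mul e1 le_rfl hux' (by positivity)
    have e4 := mul_le_mul e2 hyx huy (by positivity)
    rw [Subtype.dist_eq]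
    refine (hd.trans (add_le_add e3 e4)).trans ?_
    rw [hM1]
    push_cast
    have e5 : (n : ℝ) ^ L ≤ 2 * ((n : ℝ) ^ L - 1) := by linarith
    calc (n : ℝ) ^ L * ux + m * (n : ℝ) ^ L * (m * ux) = (1 + m ^ 2) * ux * (n : ℝ) ^ L := by ring
      _ ≤ (1 + m ^ 2) * ux * (2 * ((n : ℝ) ^ L - 1)) := by gcongr
      _ = (4 + 4 * m ^ 2) * (((n : ℝ) ^ L - 1) * (ux / 2)) := by ring
      _ ≤ (4 + 4 * m ^ 2 + numRows A) * (((n : ℝ) ^ L - 1) * (ux / 2)) := by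
        exact mul_le_mul_of_nonneg_right (by linarith) (mul_nonneg (by linarith) (by linarith))
  · rw [hcard]
    refine (rpow_le_mul_natCast_pow hm hs le_rfl ((Nat.sub_le _ _).trans h2)).trans ?_
    push_cast
    have : (0 : ℝ) ≤ (numRows A : ℝ) ^ L' := by positivity
    gcongr
    nlinarith

/-- The curves are vertical, indexed by words in the row j. Here `τ` varies along a curve, so points
of different curves are only guaranteed to be ux / 2 apart. -/
theorem hasChainGrid_of_rows_nonempty (hm : 2 ≤ m) (hmn : m < n) (hrows : ∀ j, rowCount A j ≠ 0)
    (j : Fin m) (N : ℕ) :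
    ∃ M ≥ N, HasChainGrid (carpet A) ((1 + 12 * m + rowCount A j : ℕ) : ℝ≥0)
      (Real.logb n (rowCount A j)) M := by
  have hn : 0 < n := by omega
  have hm0 : 0 < m := by omega
  obtain ⟨i₀, hi₀⟩ := rowCount_ne_zero.1 (hrows j)
  obtain ⟨L, hL⟩ := exists_pow_ge hm hmn N
  obtain ⟨L', ux, uy, p, τ, hux, hxy, hyx, h1, h2, hmem, hx, hτ, hy⟩ := exists_grid hm hmn hi₀ L
  have hNL : N + 2 ≤ m ^ L' := Nat.le_of_mul_le_mul_left (hL.trans h2) hm0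
  have hM1 : ((m ^ L' - 1 : ℕ) : ℝ) = (m : ℝ) ^ L' - 1 := by
    push_cast [show 1 ≤ m ^ L' by omega]
    rfl
  have hZ : ∀ i ≤ m ^ L' - 1, digitPrefix m (fun q => paddedDigits hm0 L' i q) L' = i :=
    fun i hi => digitPrefix_div i L' (by omega)
  let pt : ℕ → (Fin L → {i // (i, j) ∈ A}) → carpet A := fun i w =>
    ⟨p (extendWord i₀ w) (paddedDigits hm0 L' i),
      hmem _ _ (extendWord_mem (P := fun i => (i, j) ∈ A) hi₀ w) (fun q => hrows _)⟩
  have hX : ∀ i i' w w', (pt i w).1 0 - (pt i' w').1 0 =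
      ((digitPrefix n (fun q => extendWord i₀ w q) L : ℝ) -
        digitPrefix n (fun q => extendWord i₀ w' q) L +
          (τ (paddedDigits hm0 L' i) - τ (paddedDigits hm0 L' i'))) * ux :=
    fun i i' w w' => hx _ _ _ _
  have hY : ∀ i ≤ m ^ L' - 1, ∀ i' ≤ m ^ L' - 1, ∀ w w', (pt i w).1 1 - (pt i' w').1 1 =
      ((i : ℝ) - i') * uy := by
    intro i hi i' hi' w w'
    rw [hy, hZ i hi, hZ i' hi']
  have hux' : 0 ≤ ux := hux.le
  have huy : 0 < uy := hux.trans_le hxy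
  have hm' : (2 : ℝ) ≤ m := by exact_mod_cast hm
  have hmL : (2 : ℝ) ≤ (m : ℝ) ^ L' := by exact_mod_cast (show 2 ≤ m ^ L' by omega)
  have hcard : Fintype.card (Fin L → {i // (i, j) ∈ A}) = rowCount A j ^ L := by
    rw [Fintype.card_fun, Fintype.card_fin, card_row]
  have ht : 1 ≤ rowCount A j := Nat.one_le_iff_ne_zero.2 (hrows j)
  have ht' : (0 : ℝ) ≤ rowCount A j := Nat.cast_nonneg _
  refine ⟨m ^ L' - 1, by omega, _, inferInstance, pt, ux / 2, by positivity,
    ⟨fun _ => ⟨i₀, hi₀⟩⟩,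
    fun i hi w => ?_, fun i hi i' hi' w w' hne => ?_, fun w => ?_, fun i hi i' hi' w w' => ?_, ?_⟩
  · have hd := dist_le_abs_coord_sub_add (pt i w).1 (pt (i + 1) w).1
    rw [hX, hY i hi.le (i + 1) hi, sub_self, zero_add, abs_mul, abs_mul, abs_of_pos hux, abs_of_pos huy,
      Nat.cast_add_one, sub_add_cancel_left, abs_neg, abs_one, one_mul] at hd
    have e1 := mul_le_mul_of_nonneg_right
      (hτ (paddedDigits hm0 L' i) (paddedDigits hm0 L' (i + 1))) hux'
    rw [Subtype.dist_eq]
    push_cast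
    nlinarith [mul_nonneg (by positivity : (0 : ℝ) ≤ 10 * m + rowCount A j) hux']
  · rw [Subtype.dist_eq]
    by_cases hw : w = w'
    · subst hw
      have hii : i ≠ i' := fun h => hne (by rw [h])
      have hd := abs_coord_sub_le_dist (pt i w).1 (pt i' w).1 1
      rw [hY _ hi _ hi', abs_mul, abs_of_pos huy] at hd
      nlinarith [one_le_abs_natCast_sub hii]
    · have hd := abs_coord_sub_le_dist (pt i w).1 (pt i' w').1 0
      rw [hX, abs_mul, abs_of_pos hux] at hd
      have e1 := one_le_abs_digitPrefix_sub (c := i₀) hw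
      have e2 := hτ (paddedDigits hm0 L' i) (paddedDigits hm0 L' i')
      have e3 := abs_sub_abs_le_abs_add ((digitPrefix n (fun q => extendWord i₀ w q) L : ℝ) -
        digitPrefix n (fun q => extendWord i₀ w' q) L)
        (τ (paddedDigits hm0 L' i) - τ (paddedDigits hm0 L' i'))
      nlinarith
  · have hd := abs_coord_sub_le_dist (pt 0 w).1 (pt (m ^ L' - 1) w).1 1
    rw [hY _ (Nat.zero_le _) _ le_rfl, abs_mul, abs_of_pos huy, Nat.cast_zero,
      zero_sub, abs_neg, Nat.abs_cast] at hd
    rw [Subtype.dist_eq]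
    have h3 : ((m ^ L' - 1 : ℕ) : ℝ) * (ux / 2) ≤ (m ^ L' - 1 : ℕ) * uy := by
      gcongr
      linarith
    have h4 : dist (pt 0 w).1 (pt (m ^ L' - 1) w).1 ≤
        (1 + 12 * m + rowCount A j : ℕ) * dist (pt 0 w).1 (pt (m ^ L' - 1) w).1 := by
      refine le_mul_of_one_le_left dist_nonneg ?_
      push_cast
      linarith
    rw [NNReal.coe_natCast]
    linarith
  · have hd := dist_le_abs_coord_sub_add (pt i w).1 (pt i' w').1
    rw [hX, hY _ hi _ hi', abs_mul, abs_mul, abs_of_pos hux, abs_of_pos huy] at hd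
    have e0 : |(digitPrefix n (fun q => extendWord i₀ w q) L : ℝ) -
        digitPrefix n (fun q => extendWord i₀ w' q) L| ≤ (m * m ^ L' : ℕ) :=
      abs_natCast_sub_le ((digitPrefix_lt (fun i => Fin.is_lt _) _).le.trans h2)
        ((digitPrefix_lt (fun i => Fin.is_lt _) _).le.trans h2)
    push_cast at e0
    have e1 : |(digitPrefix n (fun q => extendWord i₀ w q) L : ℝ) -
        digitPrefix n (fun q => extendWord i₀ w' q) L +
          (τ (paddedDigits hm0 L' i) - τ (paddedDigits hm0 L' i'))| ≤ 2 * (m * (m : ℝ) ^ L') :=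
      (abs_add_le _ _).trans (by
        nlinarith [hτ (paddedDigits hm0 L' i) (paddedDigits hm0 L' i')])
    have e2 : |(i : ℝ) - i'| ≤ (m : ℝ) ^ L' := by
      have := abs_natCast_sub_le hi hi'
      linarith
    have e3 := mul_le_mul e1 le_rfl hux' (by positivity)
    have e4 := mul_le_mul e2 hyx huy.le (by positivity)
    rw [Subtype.dist_eq]
    refine (hd.trans (add_le_add e3 e4)).trans ?_
    rw [hM1]
    push_cast
    have e5 : (m : ℝ) ^ L' ≤ 2 * ((m : ℝ) ^ L' - 1) := by linarith
    calc 2 * (m * (m : ℝ) ^ L') * ux + (m : ℝ) ^ L' * (m * ux) = 3 * m * ux * (m : ℝ) ^ L' := by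
          ring
      _ ≤ 3 * m * ux * (2 * ((m : ℝ) ^ L' - 1)) := by gcongr
      _ = 12 * m * (((m : ℝ) ^ L' - 1) * (ux / 2)) := by ring
      _ ≤ (1 + 12 * m + rowCount A j) * (((m : ℝ) ^ L' - 1) * (ux / 2)) := by
        exact mul_le_mul_of_nonneg_right (by linarith) (mul_nonneg (by linarith) (by linarith))
  · rw [hcard]
    refine (rpow_le_mul_natCast_pow (by omega) ht hmn.le ((Nat.sub_le _ _).trans h1)).trans ?_
    push_cast
    have : (0 : ℝ) ≤ (rowCount A j : ℝ) ^ L := by positivity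
    gcongr
    linarith

end Grid

/-! ### Comparison of the two dimensions -/

section Main

theorem conformalAssouadDim_le_assouadDim (X : Type u) [inst : MetricSpace X] :
    conformalAssouadDim X ≤ assouadDim X :=
  iInf₂_le_of_le X inst (iInf₂_le_of_le (Homeomorph.refl X)
    ⟨Homeomorph.refl _, fun _ _ _ _ h => h⟩ le_rfl)

theorem le_conformalAssouadDim_of_hasChainGrid {X : Type u} [MetricSpace X] {H : ℝ≥0} {D : ℝ}
    (hD : 0 ≤ D) (hgrid : ∀ N, ∃ M ≥ N, HasChainGrid X H D M) :
    ENNReal.ofReal (1 + D) ≤ conformalAssouadDim X := by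
  refine le_iInf₂ fun Y _ => le_iInf₂ fun f hf => le_iInf₂ fun α hα => ?_
  obtain ⟨hα, C, hC, hcov⟩ := hα
  exact ENNReal.ofReal_le_of_le_toReal
    (one_add_le_of_hasChainGrid hf hD (by exact_mod_cast hα) hC hcov hgrid)

variable {n m : ℕ} {A : Finset (Fin n × Fin m)}

theorem assouadDim_carpet_le (hm : 2 ≤ m) (hmn : m < n) (hA : A.Nonempty)
    (hpos : 0 < carpetDim A) : assouadDim (carpet A) ≤ ENNReal.ofReal (carpetDim A) := by
  obtain ⟨C, hC, hcov⟩ := exists_covers_carpet hm hmn hA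
  refine iInf₂_le_of_le (Real.toNNReal (carpetDim A))
    ⟨Real.toNNReal_pos.2 hpos, C, by linarith, ?_⟩ le_rfl
  rw [Real.coe_toNNReal _ hpos.le]
  exact fun x r R hr hrR _ => hcov x r R hr (by linarith)

theorem exists_rowCount_eq_maxRow (hm : 0 < m) : ∃ j, rowCount A j = maxRow A := by
  have : (Finset.univ : Finset (Fin m)).Nonempty := ⟨⟨0, hm⟩, Finset.mem_univ _⟩
  obtain ⟨j, -, hj⟩ := Finset.exists_mem_eq_sup _ this (rowCount A)
  exact ⟨j, hj.symm⟩

theorem rowCount_le (j : Fin m) : rowCount A j ≤ n := by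
  rw [← card_row]
  exact (Fintype.card_subtype_le _).trans (Fintype.card_fin n).le

theorem mem_of_rowCount_eq {j : Fin m} (h : rowCount A j = n) (i : Fin n) : (i, j) ∈ A := by
  rw [← card_row, Fintype.card_subtype] at h
  have := (Finset.card_eq_iff_eq_univ _).1 (h.trans (Fintype.card_fin n).symm)
  simpa using this.ge (Finset.mem_univ i)

theorem rowCount_ne_zero_of_numRows_eq (h : numRows A = m) (j : Fin m) : rowCount A j ≠ 0 := by
  have := (Finset.card_eq_iff_eq_univ _).1 (h.trans (Fintype.card_fin m).symm)
  simpa using this.ge (Finset.mem_univ j)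

theorem numRows_le : numRows A ≤ m :=
  (Finset.card_le_univ _).trans (Fintype.card_fin m).le

theorem conformalAssouadDim_carpet_eq_assouadDim (hm : 2 ≤ m) (hmn : m < n) (hA : A.Nonempty)
    (h : maxRow A = n ∨ numRows A = m) :
    conformalAssouadDim (carpet A) = assouadDim (carpet A) := by
  have hT : 0 ≤ Real.logb n (maxRow A) :=
    logb_natCast_nonneg (by omega) (one_le_maxRow hA)
  have hS : 0 ≤ Real.logb m (numRows A) := logb_natCast_nonneg hm (one_le_numRows hA)
  obtain ⟨j, hj⟩ := exists_rowCount_eq_maxRow (A := A) (show 0 < m by omega)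
  have hself : ∀ b : ℕ, 2 ≤ b → Real.logb b b = 1 := fun b hb =>
    Real.logb_self_eq_one (by exact_mod_cast (show 1 < b by omega))
  -- Positivity is needed because admissible exponents are positive; it holds since one of the two
  -- terms is 1.
  have hle : ENNReal.ofReal (carpetDim A) ≤ conformalAssouadDim (carpet A) ∧
      0 < carpetDim A := by
    rcases h with h | h
    · rw [carpetDim, h, hself n (by omega)]
      exact ⟨le_conformalAssouadDim_of_hasChainGrid hS
        (hasChainGrid_of_full_row hm hmn (mem_of_rowCount_eq (hj.trans h))), by linarith⟩
    · rw [carpetDim, h, hself m hm, ← hj, add_comm]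
      rw [← hj] at hT
      exact ⟨le_conformalAssouadDim_of_hasChainGrid hT
        (hasChainGrid_of_rows_nonempty hm hmn (rowCount_ne_zero_of_numRows_eq h) j), by linarith⟩
  exact le_antisymm (conformalAssouadDim_le_assouadDim _)
    ((assouadDim_carpet_le hm hmn hA hle.2).trans hle.1)

end Main

end Carpet

theorem theorem2 (n m : ℕ) (hm : 2 ≤ m) (hmn : m < n)
    (A : Finset (Fin n × Fin m)) (hA : A.Nonempty) :
    (Carpet.maxRow A < n ∧ Carpet.numRows A < m →
      Carpet.conformalAssouadDim (Carpet.carpet A) = 0) ∧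
    (¬ (Carpet.maxRow A < n ∧ Carpet.numRows A < m) →
      Carpet.conformalAssouadDim (Carpet.carpet A) = Carpet.assouadDim (Carpet.carpet A)) := by
  refine ⟨fun h => Carpet.conformalAssouadDim_carpet_eq_zero hm hmn hA h.2 h.1, fun h =>
    Carpet.conformalAssouadDim_carpet_eq_assouadDim hm hmn hA ?_⟩
  have h1 : Carpet.maxRow A ≤ n := Finset.sup_le fun j _ => Carpet.rowCount_le j
  have h2 := Carpet.numRows_le (A := A)
  omega
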